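/- **Setting.** Fix a dimension $d\ge 0$, an order $r\ge 0$ and a real normed space $V$ of field values. A Lagrangian is a function $\mathcal L(g^{\mu\nu},\varphi,\partial\varphi,\dots,\partial^r\varphi)$ of a symmetric inverse metric (entering algebraically) and of the $r$-jet of a field $\varphi:\mathbb R^d\to V$. Its Hilbert stress tensor is $T_{\mu\nu}[\mathcal L]=-2\,\partial\mathcal L/\partial g^{\mu\nu}+g_{\mu\nu}\mathcal L$. For a constant metric $g_0$ (Euclidean, Minkowski or other) its equations of motion on an open set $\Omega\subseteq\mathbb R^d$ are the Euler–Lagrange equations $$\sum_{k\le r}(-1)^k\sum_{\mu_1,\dots,\mu_k}\partial_{\mu_1}\cdots\partial_{\mu_k}\frac{\partial\mathcal L}{\partial(\partial_{\mu_1}\cdots\partial_{\mu_k}\varphi)}\Big|_{g=g_0}=0\quad\text{on }\Omega .$$ Let $f(g,T)$ be a real function on an open set $U$ of pairs of symmetric tensors, smooth in $(g,T)$ and analytic in $T$, with $f(g,0)=0$ and $\frac{\partial f}{\partial T}(g,0)=0$ whenever $(g,0)\in U$ (so $f$ is at least quadratic in $T$). Let $D$ be an open set of pairs (nondegenerate inverse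 metric, jet) and let $\mathcal L_0$ be a Lagrangian which is smooth on $D$ and satisfies $(g,T[\mathcal L_0])\in U$ on $D$. The flow equation is $\partial_\gamma\mathcal L^{(\gamma)}=f(g,T[\mathcal L^{(\gamma)}])$, with $\mathcal L^{(0)}=\mathcal L_0$. Its solution through order $\gamma^k$ is defined by $$\mathcal L^{0}=\mathcal L_0,\qquad \mathcal L^{k+1}=\mathcal L^k+\frac{\gamma^{k+1}}{k+1}\Big[f(g,T[\mathcal L^k])\Big]_{\gamma^k},$$ where $[h]_{\gamma^k}=\frac1{k!}h^{(k)}(0)$. Call a field $\varphi^*$ *undeformed* by a Lagrangian $\mathcal L$ if, on $\Omega$ and at $g=g_0$: $\varphi^*$ solves the equations of motion of $\mathcal L$; $T_{\mu\nu}[\mathcal L](\varphi^*)=0$; and $\mathcal L(\varphi^*)=\mathcal L_0(\varphi^*)$. **Theorem.** Let $\varphi^*$ be a $C^{2r}$ field on $\Omega$ whose jets over $\Omega$, paired with $g_0$, lie in $D$. Suppose that on $\Omega$, at $g=g_0$, $\varphi^*$ solves the equations of motion of $\mathcal L_0$ and $T_{\mu\nu}[\mathcal L_0](\varphi^*)=0$.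 Then: 1. (Order by order.) For every $k\ge 0$ and every $\gamma\in\mathbb R$, $\varphi^*$ is undeformed by $\mathcal L^k$. 2. (Sum of the expansion.) If, for some $\gamma\in\mathbb R$, $\mathcal L^k\to\mathcal L^{(\gamma)}$ as $k\to\infty$ locally uniformly on $D$, and the first derivatives of $\mathcal L^k$ also converge locally uniformly on $D$, then $\varphi^*$ is undeformed by $\mathcal L^{(\gamma)}$. 3. (Whole flow.) If $J\ni 0$ is an open interval and $(\mathcal L^{(\gamma)})_{\gamma\in J}$, smooth jointly in $\gamma\in J$ and in the metric and jet in $D$, solves the flow equation on $D$ with $\mathcal L^{(0)}=\mathcal L_0$ and $(g,T[\mathcal L^{(\gamma)}])\in U$ throughout, then $\varphi^*$ is undeformed by $\mathcal L^{(\gamma)}$ for every $\gamma\in J$. In particular, the theorem covers the following two cases, in both of which $\Omega$ is open, $g_0$ is Euclidean and the sign is fixed. * ($\mathbb{CP}^{N-1}$, $d=2$.) Let $\varphi:\Omega\to\mathbb C^N$ be smooth with $\varphi^\dagger\varphi=1$ and $D_\mu\varphi\pm i\epsilon_{\mu\nu}D_\nu\varphi=0$, where $D_\mu\varphi=\partial_\mu\varphi-iA_\mu\varphi$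 and $A_\mu=\frac i2\big((\partial_\mu\varphi^\dagger)\varphi-\varphi^\dagger\partial_\mu\varphi\big)$. Then there is a smooth real Lagrange multiplier $\lambda$ on $\Omega$ such that $(\varphi,\lambda)$ solves the equations of motion of $\mathcal L_0=g^{\mu\nu}(D_\mu\varphi)^\dagger D_\nu\varphi-\lambda(\varphi^\dagger\varphi-1)$, has vanishing stress tensor, and satisfies conclusions 1–3 for all $f,U,D$ as above. * (Yang–Mills, $d=4$.) Let $A$ be a smooth gauge potential on $\Omega$ for a compact gauge algebra, given by totally antisymmetric structure constants $c^a{}_{be}$ satisfying the Jacobi identity, and let $F^a_{\mu\nu}=\partial_\mu A^a_\nu-\partial_\nu A^a_\mu+c^a{}_{be}A^b_\mu A^e_\nu$ satisfy $F_{\mu\nu}=\pm\frac12\epsilon_{\mu\nu\rho\sigma}F_{\rho\sigma}$. Then $A$ solves the equations of motion of $\mathcal L_0=\frac14 g^{\mu\rho}g^{\nu\sigma}F^a_{\mu\nu}F^a_{\rho\sigma}$, has vanishing stress tensor, and satisfies conclusions 1–3 for all $f,U,D$ as above. -/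

import Mathlib

open Filter Topology
open scoped ContDiff

/-! ## Classical field theories coupled algebraically to a metric -/

/-- Real symmetric 2-tensors on `ℝ^d`, as arrays of components. The same space of arrays is used for
inverse metrics `g^{μν}` (upper indices) and for stress tensors `T_{μν}` (lower indices). -/
def SymTensor (d : ℕ) : Submodule ℝ (Fin d → Fin d → ℝ) where
  carrier := {a | ∀ μ ν, a μ ν = a ν μ}
  zero_mem' := fun _ _ => rfl
  add_mem' := fun {a b} ha hb μ ν => by simp [ha μ ν, hb μ ν]
  smul_mem' := fun c a ha μ ν => by simp [ha μ ν]

/-- Jets of order `r` of `V`-valued fields on `ℝ^d`: the component at `k ≤ r` and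
`I = (μ₁, …, μ_k)` stands for `∂_{μ₁} ⋯ ∂_{μ_k} φ`. All index tuples are kept as coordinates;
a function of symmetric jets is regarded as a function of all jets through symmetrization. -/
abbrev Jet (d r : ℕ) (V : Type*) := (k : Fin (r + 1)) → (Fin k → Fin d) → V

/-- Lagrangian densities `L(g^{μν}, φ, ∂φ, …, ∂^r φ)`; they depend on the background metric
algebraically (through the inverse metric), and not explicitly on the point of spacetime. -/
abbrev Lagrangian (d r : ℕ) (V : Type*) := SymTensor d × Jet d r V → ℝ

/-- The constant Euclidean metric `δ^{μν}`. -/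
def euclideanMetric (d : ℕ) : SymTensor d :=
  ⟨fun μ ν => if μ = ν then 1 else 0, fun μ ν => by simp [eq_comm]⟩

/-- The symmetrized elementary tensor `(e_μ ⊗ e_ν + e_ν ⊗ e_μ) / 2`: the derivative of a function of
`g` in this direction is its symmetric partial derivative `∂/∂g^{μν}`. -/
noncomputable def metricDirection {d : ℕ} (μ ν : Fin d) : SymTensor d :=
  ⟨fun a b => ((if a = μ ∧ b = ν then 1 else 0) + (if a = ν ∧ b = μ then 1 else 0)) / 2,
    fun a b => by simp only [and_comm, add_comm]⟩

theorem metricDirection_comm {d : ℕ} (μ ν : Fin d) :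
    metricDirection μ ν = metricDirection ν μ :=
  Subtype.ext (by funext a b; simp only [metricDirection, add_comm])

theorem inv_metric_symm {d : ℕ} (g : SymTensor d) (μ ν : Fin d) :
    (Matrix.of g.1)⁻¹ μ ν = (Matrix.of g.1)⁻¹ ν μ := by
  have h : (Matrix.of g.1).transpose = Matrix.of g.1 := by
    ext a b; exact g.2 b a
  have h2 := Matrix.transpose_nonsing_inv (Matrix.of g.1)
  rw [h] at h2
  exact congrFun (congrFun h2.symm μ) ν

section FieldTheory

variable {d r : ℕ} {V : Type*} [NormedAddCommGroup V] [NormedSpace ℝ V]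

/-- The Hilbert stress tensor `T_{μν} = -2 ∂L/∂g^{μν} + g_{μν} L`, as a function of metric and jet. -/
noncomputable def stress (L : Lagrangian d r V) (p : SymTensor d × Jet d r V) : SymTensor d :=
  ⟨fun μ ν => -2 * fderiv ℝ (fun h : SymTensor d => L (h, p.2)) p.1 (metricDirection μ ν)
      + (Matrix.of p.1.1)⁻¹ μ ν * L p,
    fun μ ν => congrArg₂ (fun a b => -2 * a + b * L p)
      (congrArg _ (metricDirection_comm μ ν)) (inv_metric_symm p.1 μ ν)⟩

/-- The iterated partial derivative `∂_{I 0} ⋯ ∂_{I (k-1)} F` at `x`. -/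
noncomputable def partialDeriv {W : Type*} [NormedAddCommGroup W] [NormedSpace ℝ W] {k : ℕ}
    (I : Fin k → Fin d) (F : (Fin d → ℝ) → W) (x : Fin d → ℝ) : W :=
  iteratedFDeriv ℝ k F x (fun i => Pi.single (I i) 1)

/-- The `r`-jet of the field `φ` at `x`. -/
noncomputable def jet (r : ℕ) (φ : (Fin d → ℝ) → V) (x : Fin d → ℝ) : Jet d r V :=
  fun _ I => partialDeriv I φ x

/-- The Euler–Lagrange expression of `L` in the constant background `g₀`, in the field direction `v`:
`∑_{k ≤ r} (-1)^k ∑_I ∂_I (∂L/∂(∂_I φ) · v)`, evaluated along the field `φ` at the point `x`. -/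
noncomputable def eulerLagrange (L : Lagrangian d r V) (g₀ : SymTensor d)
    (φ : (Fin d → ℝ) → V) (x : Fin d → ℝ) (v : V) : ℝ :=
  ∑ k : Fin (r + 1), (-1 : ℝ) ^ (k : ℕ) * ∑ I : Fin k → Fin d,
    partialDeriv I
      (fun y => fderiv ℝ (fun j : Jet d r V => L (g₀, j)) (jet r φ y) (Pi.single k (Pi.single I v)))
      x

/-- `φ` solves the equations of motion of `L` on `Ω`, in the constant background `g₀`. -/
def SolvesEOM (L : Lagrangian d r V) (g₀ : SymTensor d) (Ω : Set (Fin d → ℝ))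
    (φ : (Fin d → ℝ) → V) : Prop :=
  ∀ x ∈ Ω, ∀ v : V, eulerLagrange L g₀ φ x v = 0

/-- The stress tensor of `L` vanishes identically on the field `φ` on `Ω`. -/
def StressVanishes (L : Lagrangian d r V) (g₀ : SymTensor d) (Ω : Set (Fin d → ℝ))
    (φ : (Fin d → ℝ) → V) : Prop :=
  ∀ x ∈ Ω, stress L (g₀, jet r φ x) = 0

/-! ## Flows driven by functions of the stress tensor -/

/-- `f(g, T)` is an admissible deforming function on `U`: it is smooth in `(g, T)`, analytic in the
stress tensor `T`, and has `f = 0` and `∂f/∂T = 0` at `T = 0`. (The metric enters through the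
contraction of indices.) -/
structure IsStressFunction (f : SymTensor d × SymTensor d → ℝ)
    (U : Set (SymTensor d × SymTensor d)) : Prop where
  isOpen : IsOpen U
  smooth : ContDiffOn ℝ ∞ f U
  analytic : ∀ g T, (g, T) ∈ U → AnalyticAt ℝ (fun S => f (g, S)) T
  zero : ∀ g, (g, 0) ∈ U → f (g, 0) = 0
  deriv_zero : ∀ g, (g, 0) ∈ U → fderiv ℝ (fun S => f (g, S)) 0 = 0

/-- The coefficient of `γ^k` in the Taylor expansion of `h` at `0`. -/
noncomputable def taylorCoeffZero (k : ℕ) (h : ℝ → ℝ) : ℝ :=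
  iteratedDeriv k h 0 / (k.factorial : ℝ)

/-- The solution, through order `γ^k`, of the flow `∂L/∂γ = f(T[L])` with seed `L₀`:
`L^0 = L₀` and `L^{k+1} = L^k + γ^{k+1}/(k+1) [f(T[L^k])]_{γ^k}`. -/
noncomputable def flowApprox (f : SymTensor d × SymTensor d → ℝ) (L₀ : Lagrangian d r V) :
    ℕ → ℝ → Lagrangian d r V
  | 0 => fun _ => L₀
  | k + 1 => fun γ p => flowApprox f L₀ k γ p + γ ^ (k + 1) / ((k : ℝ) + 1) *
      taylorCoeffZero k (fun γ' => f (p.1, stress (flowApprox f L₀ k γ') p))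

/-- The seed `L₀` is a smooth Lagrangian on the open set `D` of (nondegenerate) metrics and jets, the
values of its stress tensor lie in the domain `U` of the deforming function, and `D` contains the
jets of the field `φ` on `Ω`. -/
structure IsSeed (L₀ : Lagrangian d r V) (D : Set (SymTensor d × Jet d r V))
    (U : Set (SymTensor d × SymTensor d)) (g₀ : SymTensor d) (Ω : Set (Fin d → ℝ))
    (φ : (Fin d → ℝ) → V) : Prop where
  isOpen : IsOpen D
  nondegenerate : ∀ p ∈ D, (Matrix.of p.1.1).det ≠ 0
  smooth : ContDiffOn ℝ ∞ L₀ D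
  stress_mem : ∀ p ∈ D, (p.1, stress L₀ p) ∈ U
  jet_mem : ∀ x ∈ Ω, (g₀, jet r φ x) ∈ D

/-- Convergence `F k → L` on `D`, locally uniformly together with first derivatives. -/
def ConvergesC1 (F : ℕ → Lagrangian d r V) (L : Lagrangian d r V)
    (D : Set (SymTensor d × Jet d r V)) : Prop :=
  TendstoLocallyUniformlyOn F L atTop D ∧
    ∃ G : SymTensor d × Jet d r V → (SymTensor d × Jet d r V →L[ℝ] ℝ),
      TendstoLocallyUniformlyOn (fun k => fderiv ℝ (F k)) G atTop D

/-- `L γ`, `γ ∈ J`, is a smooth solution on `D` of the flow `∂L/∂γ = f(T[L])` with seed `L₀`. -/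
structure IsStressFlow (f : SymTensor d × SymTensor d → ℝ) (U : Set (SymTensor d × SymTensor d))
    (L₀ : Lagrangian d r V) (D : Set (SymTensor d × Jet d r V)) (J : Set ℝ)
    (L : ℝ → Lagrangian d r V) : Prop where
  isOpen : IsOpen J
  isInterval : J.OrdConnected
  zero_mem : (0 : ℝ) ∈ J
  seed : ∀ p ∈ D, L 0 p = L₀ p
  smooth : ContDiffOn ℝ ∞ (fun q : ℝ × (SymTensor d × Jet d r V) => L q.1 q.2) (J ×ˢ D)
  stress_mem : ∀ γ ∈ J, ∀ p ∈ D, (p.1, stress (L γ) p) ∈ U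
  flow : ∀ γ ∈ J, ∀ p ∈ D, HasDerivAt (fun γ' => L γ' p) (f (p.1, stress (L γ) p)) γ

/-- The field `φ` is left undeformed when the seed `L₀` is replaced by `L`: it solves the equations
of motion of `L`, its stress tensor with respect to `L` vanishes, and the on-shell Lagrangian is the
same. -/
structure IsUndeformed (L₀ L : Lagrangian d r V) (g₀ : SymTensor d) (Ω : Set (Fin d → ℝ))
    (φ : (Fin d → ℝ) → V) : Prop where
  eom : SolvesEOM L g₀ Ω φ
  stress_zero : StressVanishes L g₀ Ω φ
  lagrangian_eq : ∀ x ∈ Ω, L (g₀, jet r φ x) = L₀ (g₀, jet r φ x)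

/-- `φ` is left undeformed by every analytic stress tensor flow of the seed `L₀`:
order by order in `γ`; for the sum of the perturbative expansion, wherever it converges; and along
every smooth solution of the flow equation. -/
def UndeformedByStressFlows (L₀ : Lagrangian d r V) (g₀ : SymTensor d) (Ω : Set (Fin d → ℝ))
    (φ : (Fin d → ℝ) → V) : Prop :=
  ∀ (f : SymTensor d × SymTensor d → ℝ) (U : Set (SymTensor d × SymTensor d))
    (D : Set (SymTensor d × Jet d r V)),
    IsStressFunction f U → IsSeed L₀ D U g₀ Ω φ →
      (∀ (k : ℕ) (γ : ℝ), IsUndeformed L₀ (flowApprox f L₀ k γ) g₀ Ω φ) ∧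
      (∀ (γ : ℝ) (L : Lagrangian d r V), ConvergesC1 (fun k => flowApprox f L₀ k γ) L D →
        IsUndeformed L₀ L g₀ Ω φ) ∧
      (∀ (J : Set ℝ) (L : ℝ → Lagrangian d r V), IsStressFlow f U L₀ D J L →
        ∀ γ ∈ J, IsUndeformed L₀ (L γ) g₀ Ω φ)

end FieldTheory

/-! ## The two instanton examples -/

/-- The Levi-Civita symbol `ε_{I 0 ⋯ I (d-1)}`. -/
def leviCivita {d : ℕ} (I : Fin d → Fin d) : ℝ :=
  Matrix.det (Matrix.of fun a b => if I a = b then (1 : ℝ) else 0)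

/-- The value of the field in a first-order jet. -/
def Jet.value {d : ℕ} {V : Type*} (j : Jet d 1 V) : V := j 0 (fun i => i.elim0)

/-- The partial derivative `∂_μ` of the field in a first-order jet. -/
def Jet.deriv {d : ℕ} {V : Type*} (j : Jet d 1 V) (μ : Fin d) : V := j 1 (fun _ => μ)

/-- `D_μ φ = ∂_μ φ - i A_μ φ` with `A_μ = (i/2) ((∂_μ φ)† φ - φ† ∂_μ φ)`, in terms of the value
`u = φ` and the derivative `w = ∂_μ φ`. -/
noncomputable def cpCovariant {N : ℕ} (u w : Fin N → ℂ) : Fin N → ℂ :=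
  w - (Complex.I * (Complex.I / 2 * (star w ⬝ᵥ u - star u ⬝ᵥ w))) • u

/-- The `ℂP^{N-1}` Lagrangian `g^{μν} (D_μ φ)† D_ν φ - λ (φ† φ - 1)` in two dimensions, for the
fields `(φ, λ)` with `λ` a Lagrange multiplier. -/
noncomputable def cpLagrangian (N : ℕ) : Lagrangian 2 1 ((Fin N → ℂ) × ℝ) := fun p =>
  (∑ μ, ∑ ν, p.1.1 μ ν *
    (star (cpCovariant p.2.value.1 (p.2.deriv μ).1) ⬝ᵥ
      cpCovariant p.2.value.1 (p.2.deriv ν).1).re)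
  - p.2.value.2 * ((star p.2.value.1 ⬝ᵥ p.2.value.1).re - 1)

/-- `φ` is a `ℂP^{N-1}` (anti-)instanton on `Ω`, for the sign `s = ±1`: `φ† φ = 1` and
`D_μ φ + s i ε_{μν} D_ν φ = 0`. -/
structure IsCPInstanton {N : ℕ} (s : ℝ) (Ω : Set (Fin 2 → ℝ)) (φ : (Fin 2 → ℝ) → Fin N → ℂ) :
    Prop where
  smooth : ContDiffOn ℝ ∞ φ Ω
  unit : ∀ x ∈ Ω, star (φ x) ⬝ᵥ φ x = 1
  chiral : ∀ x ∈ Ω, ∀ μ : Fin 2,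
    cpCovariant (φ x) (fderiv ℝ φ x (Pi.single μ 1)) +
      ((s : ℂ) * Complex.I) • ∑ ν : Fin 2, (leviCivita ![μ, ν] : ℂ) •
        cpCovariant (φ x) (fderiv ℝ φ x (Pi.single ν 1)) = 0

/-- `c a b e` are the structure constants of a compact Lie algebra in a basis that is orthonormal for
an invariant inner product: `[t_b, t_e] = ∑ a, c a b e t_a`. -/
structure IsGaugeAlgebra {m : ℕ} (c : Fin m → Fin m → Fin m → ℝ) : Prop where
  antisymm_right : ∀ a b e, c a b e = -c a e b
  antisymm_left : ∀ a b e, c a b e = -c b a e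
  jacobi : ∀ a b e l,
    ∑ k, (c k a b * c l k e + c k b e * c l k a + c k e a * c l k b) = 0

/-- The field strength `F_{μν}^a = ∂_μ A_ν^a - ∂_ν A_μ^a + c^a_{be} A_μ^b A_ν^e`, in terms of the value
`A ν a` and the derivatives `dA μ ν a = ∂_μ A_ν^a`. -/
def fieldStrength {m : ℕ} (c : Fin m → Fin m → Fin m → ℝ) (A : Fin 4 → Fin m → ℝ)
    (dA : Fin 4 → Fin 4 → Fin m → ℝ) (μ ν : Fin 4) (a : Fin m) : ℝ :=
  dA μ ν a - dA ν μ a + ∑ b, ∑ e, c a b e * A μ b * A ν e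

/-- The Yang–Mills Lagrangian `(1/4) g^{μρ} g^{νσ} F_{μν}^a F_{ρσ}^a` in four dimensions, for the
gauge potential `A_μ^a`. -/
noncomputable def ymLagrangian {m : ℕ} (c : Fin m → Fin m → Fin m → ℝ) :
    Lagrangian 4 1 (Fin 4 → Fin m → ℝ) := fun p =>
  (1 / 4) * ∑ μ, ∑ ν, ∑ ρ, ∑ σ, ∑ a, p.1.1 μ ρ * p.1.1 ν σ *
    fieldStrength c p.2.value p.2.deriv μ ν a * fieldStrength c p.2.value p.2.deriv ρ σ a

/-- `A` is a Yang–Mills (anti-)instanton on `Ω`, for the sign `s = ±1`: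
`F_{μν} = s (1/2) ε_{μνρσ} F_{ρσ}`. -/
structure IsYMInstanton {m : ℕ} (c : Fin m → Fin m → Fin m → ℝ) (s : ℝ) (Ω : Set (Fin 4 → ℝ))
    (A : (Fin 4 → ℝ) → Fin 4 → Fin m → ℝ) : Prop where
  smooth : ContDiffOn ℝ ∞ A Ω
  selfDual : ∀ x ∈ Ω, ∀ μ ν a,
    fieldStrength c (A x) (fun ρ => fderiv ℝ A x (Pi.single ρ 1)) μ ν a =
      s / 2 * ∑ ρ, ∑ σ, leviCivita ![μ, ν, ρ, σ] *
        fieldStrength c (A x) (fun κ => fderiv ℝ A x (Pi.single κ 1)) ρ σ a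

/-! The on-shell value, the stress tensor and the equations of motion see a Lagrangian only through
its value and first derivative at the jets of the field over the open set Ω (`stress_eq_stressCLM`,
`isUndeformed_of_eq_first_order`). It is therefore enough that the flow fixes this first-order data
at every point p where T[L₀] vanishes.

A stress function vanishes at (g, 0) together with its full derivative: the T-derivative by
hypothesis, the g-derivative because f(·, 0) is zero near g (`IsStressFunction.fderiv_eq_zero`). By
the chain rule f(g, T[L]) vanishes to first order at p as soon as T[L](p) = 0; the derivative of
T[L], which contains second derivatives of L, is multiplied by zero. For the expansion in γ this
gives an induction on the order (`flowApprox_first_order`), and C¹ convergence passes the result to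
the sum.

Along a genuine solution, T = 0 has to be propagated from γ = 0. The velocity f(g, T) and its
derivative in p are both O(T), since the remaining chain-rule factor is continuous in γ. As T
depends linearly on the first-order data, ∂T/∂γ = O(T) near each zero of T. Grönwall and
connectedness of the interval give T = 0 throughout (`eq_zero_of_deriv_isBigO`), and then the
first-order data is constant (`flow_first_order`).

For the two examples only the seed has to be examined. Duality makes the quadratic expression in the
field strengths, or in the covariant derivatives, a pure trace, so the stress tensor vanishes. It
also turns the divergence in the equations of motion into a dual curl: for Yang–Mills this is the
Bianchi identity (`selfDual_divergence`), and for the projective model the mixed second derivatives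
cancel and leave the curvature of the composite connection, which the multiplier absorbs
(`IsCPInstanton.covariant_divergence`). -/

/-! ### Smooth families of functions: exchanging parameter and spatial derivatives -/

section ParametricFamilies

theorem eventually_mem_slice {E : Type*} [TopologicalSpace E] {W : Set (ℝ × E)}
    (hW : IsOpen W) {γ : ℝ} {p : E} (h : (γ, p) ∈ W) :
    ∀ᶠ s in 𝓝 γ, (s, p) ∈ W :=
  (Continuous.prodMk_left p).continuousAt.eventually (hW.mem_nhds h)

variable {E : Type*} [NormedAddCommGroup E] [NormedSpace ℝ E] {W : Set (ℝ × E)} {F : ℝ × E → ℝ}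

theorem hasDerivAt_slice (hW : IsOpen W) (hF : ContDiffOn ℝ ∞ F W) {γ : ℝ} {p : E}
    (h : (γ, p) ∈ W) : HasDerivAt (fun s => F (s, p)) (fderiv ℝ F (γ, p) (1, 0)) γ := by
  have hd : HasFDerivAt F (fderiv ℝ F (γ, p)) (γ, p) :=
    ((hF.contDiffAt (hW.mem_nhds h)).differentiableAt (by simp)).hasFDerivAt
  exact hd.comp_hasDerivAt γ ((hasDerivAt_id γ).prodMk (hasDerivAt_const γ p))

theorem hasFDerivAt_slice (hW : IsOpen W) (hF : ContDiffOn ℝ ∞ F W) {γ : ℝ} {p : E}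
    (h : (γ, p) ∈ W) :
    HasFDerivAt (fun q => F (γ, q)) ((fderiv ℝ F (γ, p)).comp (ContinuousLinearMap.inr ℝ ℝ E)) p := by
  have hd : HasFDerivAt F (fderiv ℝ F (γ, p)) (γ, p) :=
    ((hF.contDiffAt (hW.mem_nhds h)).differentiableAt (by simp)).hasFDerivAt
  exact hd.comp p ((hasFDerivAt_const γ p).prodMk (hasFDerivAt_id p))

theorem contDiffOn_fderiv_smooth {E' F' : Type*} [NormedAddCommGroup E'] [NormedSpace ℝ E']
    [NormedAddCommGroup F'] [NormedSpace ℝ F'] {S : Set E'} {f : E' → F'} (hS : IsOpen S)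
    (hf : ContDiffOn ℝ ∞ f S) : ContDiffOn ℝ ∞ (fderiv ℝ f) S :=
  hf.fderiv_of_isOpen hS (by simp)

theorem contDiffOn_deriv_slice (hW : IsOpen W) (hF : ContDiffOn ℝ ∞ F W) :
    ContDiffOn ℝ ∞ (fun q : ℝ × E => deriv (fun s => F (s, q.2)) q.1) W :=
  ((contDiffOn_fderiv_smooth hW hF).clm_apply contDiffOn_const).congr
    fun _ hq => (hasDerivAt_slice hW hF hq).deriv

/-- The partial derivatives in the parameter and in the remaining variables commute. -/
theorem hasDerivAt_fderiv_slice (hW : IsOpen W) (hF : ContDiffOn ℝ ∞ F W) {γ : ℝ} {p : E}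
    (h : (γ, p) ∈ W) :
    HasDerivAt (fun s => fderiv ℝ (fun q => F (s, q)) p)
      (fderiv ℝ (fun q => deriv (fun s => F (s, q)) γ) p) γ := by
  have hF' := contDiffOn_fderiv_smooth hW hF
  have hd : HasFDerivAt (fderiv ℝ F) (fderiv ℝ (fderiv ℝ F) (γ, p)) (γ, p) :=
    ((hF'.contDiffAt (hW.mem_nhds h)).differentiableAt (by simp)).hasFDerivAt
  have h1 : HasDerivAt (fun s => (fderiv ℝ F (s, p)).comp (ContinuousLinearMap.inr ℝ ℝ E))
      ((fderiv ℝ (fderiv ℝ F) (γ, p) (1, 0)).comp (ContinuousLinearMap.inr ℝ ℝ E)) γ := by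
    have := hd.comp_hasDerivAt γ ((hasDerivAt_id γ).prodMk (hasDerivAt_const γ p))
    exact (((ContinuousLinearMap.compL ℝ E (ℝ × E) ℝ).flip
      (ContinuousLinearMap.inr ℝ ℝ E)).hasFDerivAt.comp_hasDerivAt γ this)
  have h2 : HasFDerivAt (fun q => fderiv ℝ F (γ, q) (1, 0))
      (((fderiv ℝ (fderiv ℝ F) (γ, p)).comp (ContinuousLinearMap.inr ℝ ℝ E)).flip (1, 0)) p := by
    have := hd.comp p ((hasFDerivAt_const γ p).prodMk (hasFDerivAt_id p))
    exact (ContinuousLinearMap.apply ℝ ℝ ((1, 0) : ℝ × E)).hasFDerivAt.comp p this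
  have hev : ∀ᶠ q in 𝓝 p, (γ, q) ∈ W :=
    (Continuous.prodMk_right γ).continuousAt.eventually (hW.mem_nhds h)
  have h3 : fderiv ℝ (fun q => deriv (fun s => F (s, q)) γ) p =
      (fderiv ℝ (fderiv ℝ F) (γ, p) (1, 0)).comp (ContinuousLinearMap.inr ℝ ℝ E) := by
    have he : (fun q => deriv (fun s => F (s, q)) γ) =ᶠ[𝓝 p] fun q => fderiv ℝ F (γ, q) (1, 0) :=
      hev.mono fun q hq => (hasDerivAt_slice hW hF hq).deriv
    rw [he.fderiv_eq, h2.fderiv]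
    ext v
    have hs := (hF.contDiffAt (hW.mem_nhds h)).isSymmSndFDerivAt
      (by rw [minSmoothness_of_isRCLikeNormedField]
          exact WithTop.coe_le_coe.2 (le_top : (2 : ℕ∞) ≤ ⊤))
    exact hs.eq (0, v) (1, 0)
  rw [h3]
  exact h1.congr_of_eventuallyEq
    ((eventually_mem_slice hW h).mono fun s hs => (hasFDerivAt_slice hW hF hs).fderiv)

theorem contDiffOn_iteratedDeriv_slice (hW : IsOpen W) (hF : ContDiffOn ℝ ∞ F W) (n : ℕ) :
    ContDiffOn ℝ ∞ (fun q : ℝ × E => iteratedDeriv n (fun s => F (s, q.2)) q.1) W := by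
  induction n with
  | zero => simpa using hF
  | succ n ih => simpa only [iteratedDeriv_succ] using contDiffOn_deriv_slice hW ih

/-- The spatial derivative commutes with each parameter derivative, so at every stage it is the
parameter derivative of a function that is zero near s. Only the fixed point p is involved, not its
neighbours. -/
theorem fderiv_iteratedDeriv_slice_eq_zero (hW : IsOpen W) (hF : ContDiffOn ℝ ∞ F W) {p : E}
    (h0 : ∀ s, (s, p) ∈ W → fderiv ℝ (fun q => F (s, q)) p = 0) (n : ℕ) :
    ∀ s, (s, p) ∈ W → fderiv ℝ (fun q => iteratedDeriv n (fun s => F (s, q)) s) p = 0 := by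
  induction n with
  | zero => simpa using h0
  | succ n ih =>
    intro s hs
    have h1 := hasDerivAt_fderiv_slice hW (contDiffOn_iteratedDeriv_slice hW hF n) hs
    have h2 : HasDerivAt (fun s => fderiv ℝ (fun q => iteratedDeriv n (fun s => F (s, q)) s) p)
        0 s :=
      (hasDerivAt_const s (0 : E →L[ℝ] ℝ)).congr_of_eventuallyEq
        ((eventually_mem_slice hW hs).mono ih)
    simpa only [iteratedDeriv_succ] using h1.unique h2

end ParametricFamilies

/-! ### A local Grönwall criterion, continued along an interval -/

section LinearGronwall

variable {E : Type*} [NormedAddCommGroup E] [NormedSpace ℝ E]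

theorem eventually_eq_zero_of_deriv_isBigO {X X' : ℝ → E} {t₀ : ℝ}
    (hX : ∀ᶠ t in 𝓝 t₀, HasDerivAt X (X' t) t) (h0 : X t₀ = 0) (hO : X' =O[𝓝 t₀] X) :
    ∀ᶠ t in 𝓝 t₀, X t = 0 := by
  obtain ⟨C, hC⟩ := hO.bound
  obtain ⟨δ, hδ, h⟩ := Metric.eventually_nhds_iff.mp (hX.and hC)
  have hmem : ∀ u, |u| < δ → HasDerivAt X (X' (t₀ + u)) (t₀ + u) ∧
      ‖X' (t₀ + u)‖ ≤ C * ‖X (t₀ + u)‖ := fun u hu => h (by simpa [Real.dist_eq] using hu)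
  refine Metric.eventually_nhds_iff.mpr ⟨δ, hδ, fun t ht => ?_⟩
  rw [Real.dist_eq] at ht
  -- The Grönwall lemma used below runs only to the right; σ = -1 reflects time and covers the left
  -- side.
  have key : ∀ σ : ℝ, |σ| = 1 → ∀ b, 0 ≤ b → b < δ → X (t₀ + σ * b) = 0 := by
    intro σ hσ b hb hbδ
    have hd : ∀ u ∈ Set.Icc 0 b, HasDerivAt (fun u => X (t₀ + σ * u)) (σ • X' (t₀ + σ * u)) u := by
      intro u hu
      have hu' : |σ * u| < δ := by
        rw [abs_mul, hσ, one_mul, abs_of_nonneg hu.1]; exact hu.2.trans_lt hbδ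
      have : HasDerivAt (fun u => t₀ + σ * u) σ u := by
        simpa using ((hasDerivAt_id u).const_mul σ).const_add t₀
      exact (hmem _ hu').1.scomp u this
    refine eq_zero_of_abs_deriv_le_mul_abs_self_of_eq_zero_right (K := C)
      (f' := fun u => σ • X' (t₀ + σ * u))
      (fun u hu => (hd u hu).continuousAt.continuousWithinAt)
      (fun u hu => (hd u ⟨hu.1, hu.2.le⟩).hasDerivWithinAt) (by simpa using h0)
      (fun u hu => ?_) b ⟨hb, le_rfl⟩
    have hu' : |σ * u| < δ := by
      rw [abs_mul, hσ, one_mul, abs_of_nonneg hu.1]; exact hu.2.trans hbδ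
    rw [norm_smul, Real.norm_eq_abs, hσ, one_mul]
    exact (hmem _ hu').2
  rcases le_total t₀ t with hle | hle
  · have := key 1 (by simp) (t - t₀) (by linarith) (by rwa [abs_of_nonneg (by linarith)] at ht)
    simpa using this
  · have := key (-1) (by simp) (t₀ - t) (by linarith)
      (by rwa [abs_of_nonpos (by linarith), neg_sub] at ht)
    simpa using this

/-- The set of times near which X vanishes is open. It is relatively closed in J, because X vanishes
at a limit point by continuity and the local statement applies there again. The constant in the
bound may thus vary with the point, and the bound is needed only at zeros of X. -/
theorem eq_zero_of_deriv_isBigO {X X' : ℝ → E} {J : Set ℝ} (hJ : IsOpen J)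
    (hJ' : J.OrdConnected) {t₀ : ℝ} (ht₀ : t₀ ∈ J) (hX : ∀ t ∈ J, HasDerivAt X (X' t) t)
    (h0 : X t₀ = 0) (hO : ∀ t ∈ J, X t = 0 → X' =O[𝓝 t] X) : ∀ t ∈ J, X t = 0 := by
  have hpre := hJ'.isPreconnected
  have hc : ContinuousOn X J := fun t ht => (hX t ht).continuousAt.continuousWithinAt
  have hsub := hpre.subset_of_closure_inter_subset (u := {t | ∀ᶠ s in 𝓝 t, X s = 0})
    isOpen_setOfPred_eventually_nhds
    ⟨t₀, ht₀, eventually_eq_zero_of_deriv_isBigO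
      ((hJ.eventually_mem ht₀).mono hX) h0 (hO t₀ ht₀ h0)⟩ ?_
  · exact fun t ht => (hsub ht).self_of_nhds
  · rintro t ⟨htc, ht⟩
    have hz : X t = 0 := by
      by_contra hne
      have hev := (hc.continuousAt (hJ.mem_nhds ht)).eventually_ne hne
      obtain ⟨s, hs, hs'⟩ := mem_closure_iff_nhds.mp htc _ hev
      exact hs hs'.self_of_nhds
    exact eventually_eq_zero_of_deriv_isBigO
      ((hJ.eventually_mem ht).mono hX) hz (hO t ht hz)

end LinearGronwall

/-! ### Smoothness of the stress tensor and its dependence on first-order data -/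

section StressTensor

/-- The symmetrization of an array of components, as a continuous linear map. -/
noncomputable def symmetrize (d : ℕ) : (Fin d → Fin d → ℝ) →L[ℝ] SymTensor d :=
  LinearMap.toContinuousLinearMap
    { toFun := fun a => ⟨fun μ ν => (a μ ν + a ν μ) / 2, fun μ ν => congrArg (· / 2) (add_comm _ _)⟩
      map_add' := fun a b => Subtype.ext (by funext μ ν; simp; ring)
      map_smul' := fun c a => Subtype.ext (by funext μ ν; simp; ring) }

theorem symmetrize_coe {d : ℕ} (a : SymTensor d) : symmetrize d a.1 = a :=
  Subtype.ext (by
    funext μ ν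
    change (a.1 μ ν + a.1 ν μ) / 2 = a.1 μ ν
    rw [a.2 ν μ]; ring)

theorem contDiff_component {d : ℕ} (μ ν : Fin d) :
    ContDiff ℝ ∞ (fun g : SymTensor d => g.1 μ ν) :=
  (contDiff_pi.1 (contDiff_pi.1 (SymTensor d).subtypeL.contDiff μ)) ν

/-- Symmetrization is a continuous linear retraction of all arrays onto the symmetric ones, so
smoothness can be tested on components. -/
theorem contDiffOn_symTensor {E : Type*} [NormedAddCommGroup E] [NormedSpace ℝ E] {d : ℕ}
    {T : E → SymTensor d} {S : Set E} (h : ∀ μ ν, ContDiffOn ℝ ∞ (fun x => (T x).1 μ ν) S) :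
    ContDiffOn ℝ ∞ T S :=
  ((symmetrize d).contDiff.comp_contDiffOn
    (contDiffOn_pi.2 fun μ => contDiffOn_pi.2 fun ν => h μ ν)).congr
    fun x _ => (symmetrize_coe (T x)).symm

theorem contDiff_matrix_det {E : Type*} [NormedAddCommGroup E] [NormedSpace ℝ E] {d : ℕ}
    {M : E → Matrix (Fin d) (Fin d) ℝ} (hM : ∀ i j, ContDiff ℝ ∞ (fun x => M x i j)) :
    ContDiff ℝ ∞ (fun x => (M x).det) := by
  simp only [Matrix.det_apply']
  exact ContDiff.sum fun σ _ => contDiff_const.mul (contDiff_prod fun i _ => hM _ _)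

/-- By Cramer's rule the entry is an adjugate entry, polynomial in g, divided by the determinant. -/
theorem contDiffOn_inv_metric {d : ℕ} (μ ν : Fin d) :
    ContDiffOn ℝ ∞ (fun g : SymTensor d => (Matrix.of g.1)⁻¹ μ ν)
      {g | (Matrix.of g.1).det ≠ 0} := by
  have hdet : ContDiff ℝ ∞ (fun g : SymTensor d => (Matrix.of g.1).det) :=
    contDiff_matrix_det fun i j => contDiff_component i j
  have hadj : ContDiff ℝ ∞ (fun g : SymTensor d => (Matrix.of g.1).adjugate μ ν) := by
    simp only [Matrix.adjugate_apply]
    refine contDiff_matrix_det fun i j => ?_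
    by_cases hi : i = ν
    · simp only [Matrix.updateRow_apply, hi, if_true]
      exact contDiff_const
    · simp only [Matrix.updateRow_apply, hi, if_false]
      exact contDiff_component i j
  refine ((hdet.contDiffOn.inv fun g hg => hg).mul hadj.contDiffOn).congr fun g hg => ?_
  simp [Matrix.inv_def, Ring.inverse_eq_inv']

variable {d r : ℕ} {V : Type*} [NormedAddCommGroup V] [NormedSpace ℝ V]

/-- The stress tensor as a linear function of the value and of the derivative of the Lagrangian. -/
noncomputable def stressCLM (V : Type*) [NormedAddCommGroup V] [NormedSpace ℝ V] (r : ℕ)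
    (g : SymTensor d) :
    (ℝ × (SymTensor d × Jet d r V →L[ℝ] ℝ)) →L[ℝ] SymTensor d :=
  (symmetrize d).comp <| ContinuousLinearMap.pi fun μ => ContinuousLinearMap.pi fun ν =>
    ((-2 : ℝ) • (ContinuousLinearMap.apply ℝ ℝ
      ((metricDirection μ ν, 0) : SymTensor d × Jet d r V)).comp
        (ContinuousLinearMap.snd ℝ ℝ (SymTensor d × Jet d r V →L[ℝ] ℝ))) +
      (Matrix.of g.1)⁻¹ μ ν • ContinuousLinearMap.fst ℝ ℝ (SymTensor d × Jet d r V →L[ℝ] ℝ)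

theorem fderiv_metric_slice {L : Lagrangian d r V} {p : SymTensor d × Jet d r V}
    (hL : DifferentiableAt ℝ L p) (h : SymTensor d) :
    fderiv ℝ (fun h : SymTensor d => L (h, p.2)) p.1 h = fderiv ℝ L p (h, 0) := by
  have h0 : HasFDerivAt (fun h : SymTensor d => (h, p.2))
      (ContinuousLinearMap.inl ℝ (SymTensor d) (Jet d r V)) p.1 := hasFDerivAt_prodMk_left p.1 p.2
  have := (hL.hasFDerivAt (x := (p.1, p.2))).comp p.1 h0
  exact congrArg (fun A => A h) this.fderiv

theorem fderiv_jet_slice {L : Lagrangian d r V} {p : SymTensor d × Jet d r V}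
    (hL : DifferentiableAt ℝ L p) :
    fderiv ℝ (fun j : Jet d r V => L (p.1, j)) p.2 =
      (fderiv ℝ L p).comp (ContinuousLinearMap.inr ℝ _ _) :=
  ((hL.hasFDerivAt (x := (p.1, p.2))).comp p.2
    ((hasFDerivAt_const p.1 p.2).prodMk (hasFDerivAt_id p.2))).fderiv

theorem stress_component {L : Lagrangian d r V} {p : SymTensor d × Jet d r V}
    (hL : DifferentiableAt ℝ L p) (μ ν : Fin d) :
    (stress L p).1 μ ν = -2 * fderiv ℝ L p (metricDirection μ ν, 0)
      + (Matrix.of p.1.1)⁻¹ μ ν * L p := by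
  simp only [stress, fderiv_metric_slice hL]

/-- This linearity serves twice: Lagrangians with equal first-order data at p have equal stress
there, and a bound on the evolution of the first-order data bounds the evolution of the stress. -/
theorem stress_eq_stressCLM {L : Lagrangian d r V} {p : SymTensor d × Jet d r V}
    (hL : DifferentiableAt ℝ L p) : stress L p = stressCLM V r p.1 (L p, fderiv ℝ L p) := by
  rw [← symmetrize_coe (stress L p)]
  refine congrArg _ ?_
  funext μ ν
  rw [stress_component hL]
  simp

theorem contDiffOn_stress_family {L : ℝ → Lagrangian d r V} {J : Set ℝ}
    {D : Set (SymTensor d × Jet d r V)} (hJ : IsOpen J) (hD : IsOpen D)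
    (hdet : ∀ p ∈ D, (Matrix.of p.1.1).det ≠ 0)
    (hL : ContDiffOn ℝ ∞ (fun q : ℝ × (SymTensor d × Jet d r V) => L q.1 q.2) (J ×ˢ D)) :
    ContDiffOn ℝ ∞ (fun q : ℝ × (SymTensor d × Jet d r V) => stress (L q.1) q.2) (J ×ˢ D) := by
  have hW := hJ.prod hD
  refine contDiffOn_symTensor fun μ ν => ?_
  -- The metric derivative of one member of the family is the joint derivative in a direction
  -- without γ-component.
  have h1 := (contDiffOn_fderiv_smooth hW hL).clm_apply
    (contDiffOn_const (c := ((0, (metricDirection μ ν, 0)) : ℝ × (SymTensor d × Jet d r V))))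
  have h2 : ContDiffOn ℝ ∞ (fun q : ℝ × (SymTensor d × Jet d r V) =>
      (Matrix.of q.2.1.1)⁻¹ μ ν) (J ×ˢ D) :=
    (contDiffOn_inv_metric μ ν).comp (contDiff_fst.comp contDiff_snd).contDiffOn
      fun q hq => hdet _ hq.2
  refine ((contDiffOn_const (c := (-2 : ℝ))).mul h1 |>.add (h2.mul hL)).congr fun q hq => ?_
  have hs := hasFDerivAt_slice hW hL (γ := q.1) (p := q.2) hq
  rw [stress_component (L := L q.1) hs.differentiableAt]
  have e : fderiv ℝ (L q.1) q.2 = _ := hs.fderiv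
  rw [e]
  rfl

end StressTensor

/-! ### Stress functions vanish to second order at zero stress -/

section StressFunctions

variable {d : ℕ} {f : SymTensor d × SymTensor d → ℝ} {U : Set (SymTensor d × SymTensor d)}

/-- The definition controls only the T-derivative. The metric derivative vanishes too, because U is
open and f(·, 0) is identically zero near g. -/
theorem IsStressFunction.fderiv_eq_zero (hf : IsStressFunction f U) {g : SymTensor d}
    (hg : (g, 0) ∈ U) : fderiv ℝ f (g, 0) = 0 := by
  have hd : HasFDerivAt f (fderiv ℝ f (g, 0)) (g, 0) :=
    ((hf.smooth.contDiffAt (hf.isOpen.mem_nhds hg)).differentiableAt (by simp)).hasFDerivAt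
  have hl : HasFDerivAt (fun h : SymTensor d => (h, (0 : SymTensor d)))
      (ContinuousLinearMap.inl ℝ (SymTensor d) (SymTensor d)) g := hasFDerivAt_prodMk_left g 0
  have hr : HasFDerivAt (fun S : SymTensor d => (g, S))
      (ContinuousLinearMap.inr ℝ (SymTensor d) (SymTensor d)) 0 := hasFDerivAt_prodMk_right g 0
  have h1 := hd.comp g hl
  have h2 := hd.comp (0 : SymTensor d) hr
  have e1 : (fun h => f (h, (0 : SymTensor d))) =ᶠ[𝓝 g] fun _ => 0 :=
    ((Continuous.prodMk_left (0 : SymTensor d)).continuousAt.eventually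
      (hf.isOpen.mem_nhds hg)).mono fun h hh => hf.zero h hh
  have h1' := h1.fderiv.symm.trans (e1.fderiv_eq.trans (fderiv_const_apply 0))
  have h2' := h2.fderiv.symm.trans (hf.deriv_zero g hg)
  ext v
  · simpa using congrArg (fun A => A v) h1'
  · simpa using congrArg (fun A => A v) h2'

/-- A stress function is at most of the order of the stress tensor. -/
theorem IsStressFunction.isBigO (hf : IsStressFunction f U) {g : SymTensor d}
    (hg : (g, 0) ∈ U) : (fun S => f (g, S)) =O[𝓝 0] (fun S : SymTensor d => S) := by
  have hc := hf.smooth.contDiffAt (hf.isOpen.mem_nhds hg)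
  have hd : DifferentiableAt ℝ (fun S : SymTensor d => f (g, S)) 0 :=
    (hc.differentiableAt (by simp)).comp (0 : SymTensor d)
      ((differentiableAt_const g).prodMk differentiableAt_id)
  have := HasFDerivAt.isBigO_sub (𝕜 := ℝ) (E := SymTensor d) (F := ℝ) hd.hasFDerivAt
  refine this.congr (fun S => ?_) fun S => sub_zero S
  rw [hf.zero g hg, sub_zero]

/-- The derivative of a stress function is at most of the order of the stress tensor. -/
theorem IsStressFunction.fderiv_isBigO (hf : IsStressFunction f U) {g : SymTensor d}
    (hg : (g, 0) ∈ U) : (fun S => fderiv ℝ f (g, S)) =O[𝓝 0] (fun S : SymTensor d => S) := by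
  have hc := (contDiffOn_fderiv_smooth hf.isOpen hf.smooth).contDiffAt (hf.isOpen.mem_nhds hg)
  have hd : DifferentiableAt ℝ (fun S : SymTensor d => fderiv ℝ f (g, S)) 0 :=
    (hc.differentiableAt (by simp)).comp (0 : SymTensor d)
      ((differentiableAt_const g).prodMk differentiableAt_id)
  have := HasFDerivAt.isBigO_sub (𝕜 := ℝ) (E := SymTensor d)
    (F := SymTensor d × SymTensor d →L[ℝ] ℝ) hd.hasFDerivAt
  refine this.congr (fun S => ?_) fun S => sub_zero S
  rw [hf.fderiv_eq_zero hg]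
  exact sub_zero (fderiv ℝ f (g, S))

end StressFunctions

/-! ### First-order agreement implies being undeformed -/

section Undeformed

variable {d r : ℕ} {V : Type*} [NormedAddCommGroup V] [NormedSpace ℝ V]

theorem stress_congr {L L₀ : Lagrangian d r V} {p : SymTensor d × Jet d r V}
    (hL : DifferentiableAt ℝ L p) (hL₀ : DifferentiableAt ℝ L₀ p) (h0 : L p = L₀ p)
    (h1 : fderiv ℝ L p = fderiv ℝ L₀ p) : stress L p = stress L₀ p := by
  rw [stress_eq_stressCLM hL, stress_eq_stressCLM hL₀, h0, h1]

theorem iteratedFDeriv_congr_of_eqOn {E W : Type*} [NormedAddCommGroup E] [NormedSpace ℝ E]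
    [NormedAddCommGroup W] [NormedSpace ℝ W] {F G : E → W} {Ω : Set E} (hΩ : IsOpen Ω)
    (h : Set.EqOn F G Ω) {x : E} (hx : x ∈ Ω) (k : ℕ) :
    iteratedFDeriv ℝ k F x = iteratedFDeriv ℝ k G x :=
  ((h.eventuallyEq_of_mem (hΩ.mem_nhds hx)).iteratedFDeriv ℝ k).self_of_nhds

/-- Lagrangians that agree to first order along the jets of a field have the same equations of
motion and the same stress tensor on this field. -/
theorem isUndeformed_of_eq_first_order {L L₀ : Lagrangian d r V} {g₀ : SymTensor d}
    {Ω : Set (Fin d → ℝ)} {φ : (Fin d → ℝ) → V} (hΩ : IsOpen Ω)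
    (heom : SolvesEOM L₀ g₀ Ω φ) (hT : StressVanishes L₀ g₀ Ω φ)
    (hL : ∀ x ∈ Ω, DifferentiableAt ℝ L (g₀, jet r φ x))
    (hL₀ : ∀ x ∈ Ω, DifferentiableAt ℝ L₀ (g₀, jet r φ x))
    (h0 : ∀ x ∈ Ω, L (g₀, jet r φ x) = L₀ (g₀, jet r φ x))
    (h1 : ∀ x ∈ Ω, fderiv ℝ L (g₀, jet r φ x) = fderiv ℝ L₀ (g₀, jet r φ x)) :
    IsUndeformed L₀ L g₀ Ω φ where
  eom x hx v := by
    rw [← heom x hx v]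
    unfold eulerLagrange partialDeriv
    refine Finset.sum_congr rfl fun k _ => ?_
    congr 1
    refine Finset.sum_congr rfl fun I _ => ?_
    -- The outer derivatives ∂_I act on functions of the spacetime point, so agreement of ∂L along
    -- the field on the open set Ω suffices; higher derivatives of L need not be compared.
    rw [iteratedFDeriv_congr_of_eqOn hΩ (fun y hy => ?_) hx]
    have e := fderiv_jet_slice (hL y hy)
    have e₀ := fderiv_jet_slice (hL₀ y hy)
    simp only [e, e₀, h1 y hy]
  stress_zero x hx := by
    rw [stress_congr (hL x hx) (hL₀ x hx) (h0 x hx) (h1 x hx), hT x hx]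
  lagrangian_eq := h0

end Undeformed

/-! ### The expansion in γ, its sum, and solutions of the flow equation -/

section PerturbativeFlow

/-- It places every point (0, p) with p in D in the region where f(g, T[L^k]) is smooth: the stress
there is that of the seed. -/
theorem flowApprox_zero {d r : ℕ} {V : Type*} (f : SymTensor d × SymTensor d → ℝ) (L₀ : Lagrangian d r V) (k : ℕ) :
    flowApprox f L₀ k 0 = L₀ := by
  induction k with
  | zero => rfl
  | succ k ih => funext p; simp [flowApprox, ih]

variable {d r : ℕ} {V : Type*} [NormedAddCommGroup V] [NormedSpace ℝ V]
  {f : SymTensor d × SymTensor d → ℝ} {U : Set (SymTensor d × SymTensor d)}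
  {L₀ : Lagrangian d r V} {D : Set (SymTensor d × Jet d r V)} {g₀ : SymTensor d}
  {Ω : Set (Fin d → ℝ)} {φ : (Fin d → ℝ) → V}

/-- The map `(γ, p) ↦ (g, T[L^γ](p))`, where `g` is the metric of `p`. -/
noncomputable def metricStress (L : ℝ → Lagrangian d r V)
    (q : ℝ × (SymTensor d × Jet d r V)) : SymTensor d × SymTensor d :=
  (q.2.1, stress (L q.1) q.2)

theorem contDiffOn_metricStress {L : ℝ → Lagrangian d r V} {J : Set ℝ} (hJ : IsOpen J)
    (hD : IsOpen D) (hdet : ∀ p ∈ D, (Matrix.of p.1.1).det ≠ 0)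
    (hL : ContDiffOn ℝ ∞ (fun q : ℝ × (SymTensor d × Jet d r V) => L q.1 q.2) (J ×ˢ D)) :
    ContDiffOn ℝ ∞ (metricStress L) (J ×ˢ D) :=
  (contDiff_fst.comp contDiff_snd).contDiffOn.prodMk (contDiffOn_stress_family hJ hD hdet hL)

theorem fderiv_stressFunction_comp (hf : IsStressFunction f U) {L : ℝ → Lagrangian d r V}
    {W : Set (ℝ × (SymTensor d × Jet d r V))} (hW : IsOpen W)
    (hm : ContDiffOn ℝ ∞ (metricStress L) W) (hWU : Set.MapsTo (metricStress L) W U) {γ : ℝ}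
    {p : SymTensor d × Jet d r V} (hq : (γ, p) ∈ W) :
    fderiv ℝ (fun p => f (p.1, stress (L γ) p)) p =
      (fderiv ℝ f (p.1, stress (L γ) p)).comp ((fderiv ℝ (metricStress L) (γ, p)).comp
        (ContinuousLinearMap.inr ℝ ℝ (SymTensor d × Jet d r V))) := by
  have hd : DifferentiableAt ℝ f (metricStress L (γ, p)) :=
    (hf.smooth.contDiffAt (hf.isOpen.mem_nhds (hWU hq))).differentiableAt (by simp)
  have hm' : DifferentiableAt ℝ (metricStress L) (γ, p) :=
    (hm.contDiffAt (hW.mem_nhds hq)).differentiableAt (by simp)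
  have hr : HasFDerivAt (fun p : SymTensor d × Jet d r V => (γ, p))
    (ContinuousLinearMap.inr ℝ ℝ (SymTensor d × Jet d r V)) p := hasFDerivAt_prodMk_right γ p
  exact (hd.hasFDerivAt.comp p (hm'.hasFDerivAt.comp p hr)).fderiv

/-- Smoothness and first-order agreement are proved together: smoothness of L^k makes the next
Taylor coefficient differentiable, and agreement makes that coefficient vanish to first order at p.
-/
theorem flowApprox_first_order (hf : IsStressFunction f U) (hD : IsOpen D)
    (hdet : ∀ p ∈ D, (Matrix.of p.1.1).det ≠ 0) (hL₀ : ContDiffOn ℝ ∞ L₀ D)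
    (hU : ∀ p ∈ D, (p.1, stress L₀ p) ∈ U) (k : ℕ) :
    ContDiffOn ℝ ∞ (fun q : ℝ × (SymTensor d × Jet d r V) => flowApprox f L₀ k q.1 q.2)
      (Set.univ ×ˢ D) ∧
    ∀ p ∈ D, stress L₀ p = 0 → ∀ γ, flowApprox f L₀ k γ p = L₀ p ∧
      fderiv ℝ (flowApprox f L₀ k γ) p = fderiv ℝ L₀ p := by
  have hUD : IsOpen ((Set.univ : Set ℝ) ×ˢ D) := isOpen_univ.prod hD
  induction k with
  | zero =>
    exact ⟨hL₀.comp contDiff_snd.contDiffOn fun q hq => hq.2, fun p _ _ γ => ⟨rfl, rfl⟩⟩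
  | succ k ih =>
    obtain ⟨hs, h01⟩ := ih
    have hm := contDiffOn_metricStress isOpen_univ hD hdet hs
    set L := flowApprox f L₀ k with hLdef
    -- For γ ≠ 0 the stress of L^k may leave U, where nothing is known about f. The open set W
    -- avoids this, and it contains the slice γ = 0, on which the Taylor coefficient is computed.
    set W := (Set.univ ×ˢ D) ∩ metricStress L ⁻¹' U with hWdef
    have hW : IsOpen W := hm.continuousOn.isOpen_inter_preimage hUD hf.isOpen
    have hmW : ContDiffOn ℝ ∞ (metricStress L) W := hm.mono Set.inter_subset_left
    have hWU : Set.MapsTo (metricStress L) W U := fun q hq => hq.2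
    have hF : ContDiffOn ℝ ∞ (fun q : ℝ × (SymTensor d × Jet d r V) =>
        f (q.2.1, stress (L q.1) q.2)) W := hf.smooth.comp hmW hWU
    have hzW : ∀ p ∈ D, ((0 : ℝ), p) ∈ W := fun p hp =>
      ⟨⟨trivial, hp⟩, by simpa [metricStress, hLdef, flowApprox_zero] using hU p hp⟩
    have hG : ContDiffOn ℝ ∞ (fun p => iteratedDeriv k
        (fun s => f (p.1, stress (L s) p)) 0) D :=
      (contDiffOn_iteratedDeriv_slice hW hF k).comp
        (contDiff_prodMk_right (0 : ℝ)).contDiffOn hzW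
    have hc : ContDiffOn ℝ ∞ (fun p => taylorCoeffZero k
        (fun s => f (p.1, stress (L s) p))) D := hG.div_const _
    refine ⟨hs.add (((contDiff_fst.pow (k + 1)).div_const _).contDiffOn.mul
      (hc.comp contDiff_snd.contDiffOn fun q hq => hq.2)), fun p hp hp0 γ => ?_⟩
    have hdL : ∀ γ, DifferentiableAt ℝ (L γ) p := fun γ =>
      (hasFDerivAt_slice hUD hs (γ := γ) (p := p) ⟨trivial, hp⟩).differentiableAt
    have hst : ∀ s, stress (L s) p = 0 := fun s => by
      rw [stress_congr (hdL s) ((hL₀.contDiffAt (hD.mem_nhds hp)).differentiableAt (by simp))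
        (h01 p hp hp0 s).1 (h01 p hp hp0 s).2, hp0]
    have hgU : (p.1, (0 : SymTensor d)) ∈ U := hp0 ▸ hU p hp
    have hval : taylorCoeffZero k (fun s => f (p.1, stress (L s) p)) = 0 := by
      simp [taylorCoeffZero, hst, hf.zero p.1 hgU]
    have hder : fderiv ℝ (fun p => taylorCoeffZero k (fun s => f (p.1, stress (L s) p))) p = 0 := by
      -- At this p the stress is zero for every s, so the derivative of f in the chain rule is zero
      -- for every s; the γ-derivatives then inherit this.
      have h0 := fderiv_iteratedDeriv_slice_eq_zero hW hF (p := p) (fun s hs => by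
        have := fderiv_stressFunction_comp hf hW hmW hWU hs
        rw [hst, hf.fderiv_eq_zero hgU, ContinuousLinearMap.zero_comp] at this
        exact this) k 0 (hzW p hp)
      have hd := ((hG.contDiffAt (hD.mem_nhds hp)).differentiableAt (by simp)).hasFDerivAt
      rw [h0] at hd
      simpa [taylorCoeffZero, div_eq_inv_mul] using (hd.const_mul (k.factorial : ℝ)⁻¹).fderiv
    refine ⟨by simp only [flowApprox, ← hLdef, hval, mul_zero, add_zero, (h01 p hp hp0 γ).1], ?_⟩
    have hdc := ((hc.contDiffAt (hD.mem_nhds hp)).differentiableAt (by simp)).hasFDerivAt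
    rw [hder] at hdc
    have := ((hdL γ).hasFDerivAt.add (hdc.const_mul (γ ^ (k + 1) / ((k : ℝ) + 1)))).fderiv
    rw [smul_zero, add_zero, (h01 p hp hp0 γ).2] at this
    exact this

/-- The velocity `f(g, T[L^γ])` of the flow, as a function of the metric and the jet. -/
noncomputable def flowVelocity (f : SymTensor d × SymTensor d → ℝ) (L : ℝ → Lagrangian d r V)
    (γ : ℝ) (p : SymTensor d × Jet d r V) : ℝ :=
  f (p.1, stress (L γ) p)

theorem IsStressFlow.differentiableAt {J : Set ℝ} {L : ℝ → Lagrangian d r V}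
    (hL : IsStressFlow f U L₀ D J L) (hD : IsOpen D) {p : SymTensor d × Jet d r V} (hp : p ∈ D)
    {γ : ℝ} (hγ : γ ∈ J) : DifferentiableAt ℝ (L γ) p :=
  (hasFDerivAt_slice (hL.isOpen.prod hD) hL.smooth (γ := γ) (p := p) ⟨hγ, hp⟩).differentiableAt

theorem IsStressFlow.hasDerivAt_fderiv {J : Set ℝ} {L : ℝ → Lagrangian d r V}
    (hL : IsStressFlow f U L₀ D J L) (hD : IsOpen D) {p : SymTensor d × Jet d r V} (hp : p ∈ D)
    {γ : ℝ} (hγ : γ ∈ J) :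
    HasDerivAt (fun γ => fderiv ℝ (L γ) p) (fderiv ℝ (flowVelocity f L γ) p) γ := by
  have h1 := hasDerivAt_fderiv_slice (hL.isOpen.prod hD) hL.smooth (γ := γ) (p := p) ⟨hγ, hp⟩
  have he : (fun q => deriv (fun s => L s q) γ) =ᶠ[𝓝 p] flowVelocity f L γ :=
    (hD.eventually_mem hp).mono fun q hq => (hL.flow γ hγ q hq).deriv
  have h2 : fderiv ℝ (fun q => deriv (fun s => L s q) γ) p = fderiv ℝ (flowVelocity f L γ) p :=
    he.fderiv_eq
  rw [← h2]
  exact h1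
theorem IsStressFlow.hasDerivAt_first_order {J : Set ℝ} {L : ℝ → Lagrangian d r V}
    (hL : IsStressFlow f U L₀ D J L) (hD : IsOpen D) {p : SymTensor d × Jet d r V} (hp : p ∈ D)
    {γ : ℝ} (hγ : γ ∈ J) :
    HasDerivAt (fun γ => (L γ p, fderiv ℝ (L γ) p))
      (flowVelocity f L γ p, fderiv ℝ (flowVelocity f L γ) p) γ := 
  HasDerivAt.prodMk (F := ℝ) (G := SymTensor d × Jet d r V →L[ℝ] ℝ) (hL.flow γ hγ p hp) (hL.hasDerivAt_fderiv hD hp hγ)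

theorem IsStressFlow.hasDerivAt_stress {J : Set ℝ} {L : ℝ → Lagrangian d r V}
    (hL : IsStressFlow f U L₀ D J L) (hD : IsOpen D) {p : SymTensor d × Jet d r V} (hp : p ∈ D)
    {γ : ℝ} (hγ : γ ∈ J) :
    HasDerivAt (fun γ => stress (L γ) p)
      (stressCLM V r p.1 (flowVelocity f L γ p, fderiv ℝ (flowVelocity f L γ) p)) γ := by
  have h1 := HasFDerivAt.comp_hasDerivAt (F := ℝ × (SymTensor d × Jet d r V →L[ℝ] ℝ))
    (E := SymTensor d) γ (stressCLM V r p.1).hasFDerivAt (hL.hasDerivAt_first_order hD hp hγ)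
  refine h1.congr_of_eventuallyEq
      ((hL.isOpen.eventually_mem hγ).mono fun _ hs =>
        stress_eq_stressCLM (hL.differentiableAt hD hp hs))

theorem IsStressFlow.fderiv_flowVelocity {J : Set ℝ} {L : ℝ → Lagrangian d r V}
    (hf : IsStressFunction f U) (hL : IsStressFlow f U L₀ D J L) (hD : IsOpen D)
    (hdet : ∀ p ∈ D, (Matrix.of p.1.1).det ≠ 0) {p : SymTensor d × Jet d r V} (hp : p ∈ D)
    {γ : ℝ} (hγ : γ ∈ J) :
    fderiv ℝ (flowVelocity f L γ) p = (fderiv ℝ f (p.1, stress (L γ) p)).comp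
      ((fderiv ℝ (metricStress L) (γ, p)).comp
        (ContinuousLinearMap.inr ℝ ℝ (SymTensor d × Jet d r V))) :=
  fderiv_stressFunction_comp hf (hL.isOpen.prod hD)
    (contDiffOn_metricStress hL.isOpen hD hdet hL.smooth)
    (fun _ hq => hL.stress_mem _ hq.1 _ hq.2) ⟨hγ, hp⟩

/-- The derivative of the velocity is df composed with the derivative of (g, T) in p. The first
factor is O(T); the second involves second derivatives of L but is continuous in γ, hence locally
bounded. No closed equation for T is required. -/
theorem IsStressFlow.flowVelocity_isBigO {J : Set ℝ} {L : ℝ → Lagrangian d r V}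
    (hf : IsStressFunction f U) (hL : IsStressFlow f U L₀ D J L) (hD : IsOpen D)
    (hdet : ∀ p ∈ D, (Matrix.of p.1.1).det ≠ 0) {p : SymTensor d × Jet d r V} (hp : p ∈ D)
    {γ : ℝ} (hγ : γ ∈ J) (hγ0 : stress (L γ) p = 0) :
    (fun s => (flowVelocity f L s p, fderiv ℝ (flowVelocity f L s) p)) =O[𝓝 γ]
      fun s => stress (L s) p := by
  have hB : ContinuousOn (fun γ => (fderiv ℝ (metricStress L) (γ, p)).comp
      (ContinuousLinearMap.inr ℝ ℝ (SymTensor d × Jet d r V))) J := by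
    have h1 : ContinuousOn (fun γ => fderiv ℝ (metricStress L) (γ, p)) J :=
      (contDiffOn_fderiv_smooth (hL.isOpen.prod hD)
        (contDiffOn_metricStress hL.isOpen hD hdet hL.smooth)).continuousOn.comp
        (Continuous.prodMk_left p).continuousOn fun γ hγ => ⟨hγ, hp⟩
    exact h1.clm_comp continuousOn_const
  have hgU : (p.1, (0 : SymTensor d)) ∈ U := hγ0 ▸ hL.stress_mem γ hγ p hp
  have htend : Tendsto (fun s => stress (L s) p) (𝓝 γ) (𝓝 0) :=
    hγ0 ▸ (hL.hasDerivAt_stress hD hp hγ).continuousAt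
  have hO1 : (fun s => flowVelocity f L s p) =O[𝓝 γ] fun s => stress (L s) p :=
    (hf.isBigO hgU).comp_tendsto htend
  have hO2 : (fun s => fderiv ℝ f (p.1, stress (L s) p)) =O[𝓝 γ] fun s => stress (L s) p :=
    (hf.fderiv_isBigO hgU).comp_tendsto htend
  have hb := (ContinuousAt.norm (E := SymTensor d × Jet d r V →L[ℝ] SymTensor d × SymTensor d)
    (hB.continuousAt (hL.isOpen.mem_nhds hγ))).isBigO_one ℝ
  have hle : (fun s => fderiv ℝ (flowVelocity f L s) p) =O[𝓝 γ] fun s =>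
      ‖fderiv ℝ f (p.1, stress (L s) p)‖ * ‖(fderiv ℝ (metricStress L) (s, p)).comp
        (ContinuousLinearMap.inr ℝ ℝ (SymTensor d × Jet d r V))‖ := by
    refine Asymptotics.IsBigO.of_bound 1 ((hL.isOpen.eventually_mem hγ).mono fun s hs => ?_)
    rw [hL.fderiv_flowVelocity hf hD hdet hp hs, one_mul, Real.norm_of_nonneg (by positivity)]
    exact ContinuousLinearMap.opNorm_comp_le _ _
  have hO2' : (fun s => ‖fderiv ℝ f (p.1, stress (L s) p)‖) =O[𝓝 γ] fun s => ‖stress (L s) p‖ :=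
    (Asymptotics.isBigO_norm_norm (E' := SymTensor d × SymTensor d →L[ℝ] ℝ)
      (F' := SymTensor d)).mpr hO2
  have hO3 := hle.trans (hO2'.mul hb)
  simp only [mul_one] at hO3
  exact Asymptotics.IsBigO.prod_left (E' := ℝ) (F' := SymTensor d × Jet d r V →L[ℝ] ℝ)
    (G' := SymTensor d) hO1 hO3.of_norm_right

/-- Grönwall first keeps the stress at zero along the flow; after that, the value and the first
derivative at p have zero velocity on a connected interval. -/
theorem flow_first_order (hf : IsStressFunction f U) (hD : IsOpen D)
    (hdet : ∀ p ∈ D, (Matrix.of p.1.1).det ≠ 0) {J : Set ℝ} {L : ℝ → Lagrangian d r V}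
    (hL : IsStressFlow f U L₀ D J L) {p : SymTensor d × Jet d r V} (hp : p ∈ D)
    (hp0 : stress (L 0) p = 0) :
    ∀ γ ∈ J, L γ p = L 0 p ∧ fderiv ℝ (L γ) p = fderiv ℝ (L 0) p := by
  have hT0 : ∀ γ ∈ J, stress (L γ) p = 0 :=
    eq_zero_of_deriv_isBigO hL.isOpen hL.isInterval hL.zero_mem
      (fun γ hγ => hL.hasDerivAt_stress hD hp hγ) hp0 fun γ hγ hγ0 =>
        (ContinuousLinearMap.isBigO_comp (𝕜₂ := ℝ) (𝕜₃ := ℝ) (σ₂₃ := RingHom.id ℝ)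
          (F := ℝ × (SymTensor d × Jet d r V →L[ℝ] ℝ))
          (G := SymTensor d) (stressCLM V r p.1) _ _).trans (hL.flowVelocity_isBigO hf hD hdet hp hγ hγ0)
  have hgU : ∀ γ ∈ J, (p.1, (0 : SymTensor d)) ∈ U := fun γ hγ =>
    hT0 γ hγ ▸ hL.stress_mem γ hγ p hp
  have hX0 : ∀ γ ∈ J, HasDerivAt (fun γ => L γ p) 0 γ := fun γ hγ => by
    have h := hL.flow γ hγ p hp
    rwa [hT0 γ hγ, hf.zero p.1 (hgU γ hγ)] at h
  have hX1 : ∀ γ ∈ J, HasDerivAt (fun γ => fderiv ℝ (L γ) p) 0 γ := fun γ hγ => by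
    have h := hL.hasDerivAt_fderiv hD hp hγ
    rwa [hL.fderiv_flowVelocity hf hD hdet hp hγ, hT0 γ hγ, hf.fderiv_eq_zero (hgU γ hγ),
      ContinuousLinearMap.zero_comp] at h
  exact fun γ hγ =>
    ⟨hL.isOpen.is_const_of_deriv_eq_zero hL.isInterval.isPreconnected
      (fun s hs => (hX0 s hs).differentiableAt.differentiableWithinAt)
      (fun s hs => (hX0 s hs).deriv) hγ hL.zero_mem,
    IsOpen.is_const_of_deriv_eq_zero (𝕜 := ℝ) (G := SymTensor d × Jet d r V →L[ℝ] ℝ)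
      (f := fun γ => fderiv ℝ (L γ) p) hL.isOpen hL.isInterval.isPreconnected
      (fun s hs => (hX1 s hs).differentiableAt.differentiableWithinAt)
      (fun s hs => (hX1 s hs).deriv) hγ hL.zero_mem⟩

theorem undeformedByStressFlows (hΩ : IsOpen Ω) (heom : SolvesEOM L₀ g₀ Ω φ)
    (hT : StressVanishes L₀ g₀ Ω φ) : UndeformedByStressFlows L₀ g₀ Ω φ := by
  intro f U D hf hs
  have hL₀ : ∀ x ∈ Ω, DifferentiableAt ℝ L₀ (g₀, jet r φ x) := fun x hx =>
    (hs.smooth.contDiffAt (hs.isOpen.mem_nhds (hs.jet_mem x hx))).differentiableAt (by simp)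
  have hk := fun k => flowApprox_first_order hf hs.isOpen hs.nondegenerate hs.smooth hs.stress_mem k
  have hkd : ∀ k γ, ∀ p ∈ D, DifferentiableAt ℝ (flowApprox f L₀ k γ) p := fun k γ p hp =>
    (hasFDerivAt_slice (isOpen_univ.prod hs.isOpen) (hk k).1 (γ := γ) (p := p)
      ⟨trivial, hp⟩).differentiableAt
  refine ⟨fun k γ => ?_, fun γ L hL => ?_, fun J L hL γ hγ => ?_⟩
  · exact isUndeformed_of_eq_first_order hΩ heom hT
      (fun x hx => hkd k γ _ (hs.jet_mem x hx)) hL₀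
      (fun x hx => ((hk k).2 _ (hs.jet_mem x hx) (hT x hx) γ).1)
      (fun x hx => ((hk k).2 _ (hs.jet_mem x hx) (hT x hx) γ).2)
  · obtain ⟨hL0, G, hG⟩ := hL
    -- Locally uniform convergence of derivatives identifies G as the derivative of the sum; along
    -- the field both limits are limits of constant sequences.
    have hd : ∀ p ∈ D, HasFDerivAt L (G p) p := fun p hp =>
      hasFDerivAt_of_tendstoLocallyUniformlyOn hs.isOpen hG
        (fun k q hq => (hkd k γ q hq).hasFDerivAt) (fun q hq => hL0.tendsto_at hq) hp
    refine isUndeformed_of_eq_first_order hΩ heom hT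
      (fun x hx => (hd _ (hs.jet_mem x hx)).differentiableAt) hL₀ (fun x hx => ?_) fun x hx => ?_
    · have h := hL0.tendsto_at (hs.jet_mem x hx)
      simp only [((hk _).2 _ (hs.jet_mem x hx) (hT x hx) γ).1] at h
      exact tendsto_nhds_unique h tendsto_const_nhds
    · have h := hG.tendsto_at (hs.jet_mem x hx)
      simp only [((hk _).2 _ (hs.jet_mem x hx) (hT x hx) γ).2] at h
      rw [(hd _ (hs.jet_mem x hx)).fderiv]
      exact tendsto_nhds_unique h tendsto_const_nhds
  · have h0 : ∀ x ∈ Ω, L 0 (g₀, jet r φ x) = L₀ (g₀, jet r φ x) := fun x hx =>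
      hL.seed _ (hs.jet_mem x hx)
    have h1 : ∀ x ∈ Ω, fderiv ℝ (L 0) (g₀, jet r φ x) = fderiv ℝ L₀ (g₀, jet r φ x) :=
      fun x hx => Filter.EventuallyEq.fderiv_eq
        ((hs.isOpen.eventually_mem (hs.jet_mem x hx)).mono hL.seed)
    have hLd : ∀ γ ∈ J, ∀ x ∈ Ω, DifferentiableAt ℝ (L γ) (g₀, jet r φ x) := fun γ hγ x hx =>
      (hasFDerivAt_slice (hL.isOpen.prod hs.isOpen) hL.smooth (γ := γ)
        ⟨hγ, hs.jet_mem x hx⟩).differentiableAt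
    have hfl := fun x hx => flow_first_order hf hs.isOpen hs.nondegenerate hL (hs.jet_mem x hx)
      ((stress_congr (hLd 0 hL.zero_mem x hx) (hL₀ x hx) (h0 x hx) (h1 x hx)).trans (hT x hx)) γ hγ
    exact isUndeformed_of_eq_first_order hΩ heom hT (hLd γ hγ) hL₀
      (fun x hx => (hfl x hx).1.trans (h0 x hx)) fun x hx => (hfl x hx).2.trans (h1 x hx)

end PerturbativeFlow

/-! ### First-order theories: Euler–Lagrange equations and stress via one-variable derivatives -/

section FirstOrder

variable {d : ℕ}

theorem fderiv_apply_of_hasDerivAt_line {E F : Type*} [NormedAddCommGroup E] [NormedSpace ℝ E]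
    [NormedAddCommGroup F] [NormedSpace ℝ F] {f : E → F} {x e : E} {c : F}
    (hf : DifferentiableAt ℝ f x) (h : HasDerivAt (fun t : ℝ => f (x + t • e)) c 0) :
    fderiv ℝ f x e = c := by
  rw [← hf.lineDeriv_eq_fderiv]
  exact h.deriv

theorem hasDerivAt_line {E F : Type*} [NormedAddCommGroup E] [NormedSpace ℝ E]
    [NormedAddCommGroup F] [NormedSpace ℝ F] {f : E → F} {x : E} (e : E)
    (hf : DifferentiableAt ℝ f x) : HasDerivAt (fun t : ℝ => f (x + t • e)) (fderiv ℝ f x e) 0 :=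
  hf.hasFDerivAt.hasLineDerivAt e

/-- The first-order jet with value `u` and derivatives `w`. -/
def firstJet {V : Type*} (u : V) (w : Fin d → V) : Jet d 1 V
  | ⟨0, _⟩, _ => u
  | ⟨1, _⟩, I => w (I (0 : Fin 1))

@[simp] theorem firstJet_value {V : Type*} (u : V) (w : Fin d → V) : (firstJet u w).value = u := rfl

@[simp] theorem firstJet_deriv {V : Type*} (u : V) (w : Fin d → V) (μ : Fin d) :
    (firstJet u w).deriv μ = w μ := rfl

variable {V : Type*} [NormedAddCommGroup V] [NormedSpace ℝ V]

theorem jet_one_eq (φ : (Fin d → ℝ) → V) (x : Fin d → ℝ) :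
    jet 1 φ x = firstJet (φ x) fun μ => fderiv ℝ φ x (Pi.single μ 1) := by
  funext k I
  match k, I with
  | ⟨0, _⟩, I => exact iteratedFDeriv_zero_apply (𝕜 := ℝ) (f := φ) (x := x) _
  | ⟨1, _⟩, I => exact iteratedFDeriv_one_apply (𝕜 := ℝ) (f := φ) (x := x) _

theorem firstJet_add_smul_value (u v : V) (w : Fin d → V) (t : ℝ) (I : Fin 0 → Fin d) :
    firstJet u w + t • (Pi.single (0 : Fin 2) (Pi.single I v) : Jet d 1 V) =
      firstJet (u + t • v) w := by
  funext k K
  match k, K with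
  | ⟨0, _⟩, K =>
    obtain rfl : K = I := funext fun i => i.elim0
    change u + t • (Pi.single K v : (Fin 0 → Fin d) → V) K = u + t • v
    rw [Pi.single_eq_same]
  | ⟨1, _⟩, K =>
    change w (K (0 : Fin 1)) + t • (0 : V) = w (K (0 : Fin 1))
    simp

theorem firstJet_add_smul_deriv (u v : V) (w : Fin d → V) (t : ℝ) (μ : Fin d) :
    firstJet u w + t • (Pi.single (1 : Fin 2) (Pi.single (fun _ => μ) v) : Jet d 1 V) =
      firstJet u (w + t • (Pi.single μ v : Fin d → V)) := by
  funext k K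
  match k, K with
  | ⟨0, _⟩, K =>
    change u + t • (0 : V) = u
    simp
  | ⟨1, _⟩, K =>
    change (Fin 1 → Fin d) at K
    change w (K 0) + t • (Pi.single (fun _ => μ) v : (Fin 1 → Fin d) → V) K =
      w (K 0) + t • (Pi.single μ v : Fin d → V) (K 0)
    congr 2
    by_cases h : K 0 = μ
    · obtain rfl : K = fun _ => μ := by
        funext i; rw [← h]; congr 1; exact Subsingleton.elim _ _
      simp
    · rw [Pi.single_eq_of_ne h, Pi.single_eq_of_ne fun h' => h (congrFun h' 0)]

theorem eulerLagrange_one (L : Lagrangian d 1 V) (g : SymTensor d) (φ : (Fin d → ℝ) → V)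
    (x : Fin d → ℝ) (v : V) :
    eulerLagrange L g φ x v =
      fderiv ℝ (fun j : Jet d 1 V => L (g, j)) (jet 1 φ x)
        (Pi.single (0 : Fin 2) (Pi.single (fun i => i.elim0) v)) -
      ∑ μ, fderiv ℝ (fun y => fderiv ℝ (fun j : Jet d 1 V => L (g, j)) (jet 1 φ y)
        (Pi.single (1 : Fin 2) (Pi.single (fun _ => μ) v))) x (Pi.single μ 1) := by
  unfold eulerLagrange partialDeriv
  rw [Fin.sum_univ_two, sub_eq_add_neg]
  congr 1
  · have h : (-1 : ℝ) ^ ((0 : Fin 2) : ℕ) = 1 := pow_zero _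
    rw [h, one_mul]
    refine (Fintype.sum_unique (ι := Fin 0 → Fin d) _).trans ?_
    refine (iteratedFDeriv_zero_apply _).trans ?_
    exact congrArg (fun I : Fin 0 → Fin d => fderiv ℝ (fun j : Jet d 1 V => L (g, j)) (jet 1 φ x)
      (Pi.single (0 : Fin 2) (Pi.single I v))) (Subsingleton.elim _ _)
  · have h : (-1 : ℝ) ^ ((1 : Fin 2) : ℕ) = -1 := pow_one _
    rw [h, neg_one_mul]
    congr 1
    refine Fintype.sum_equiv (Equiv.funUnique (Fin 1) (Fin d)) _ _ fun I => ?_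
    obtain ⟨μ, rfl⟩ : ∃ μ, I = fun _ => μ :=
      ⟨I 0, by funext i; congr 1; exact Subsingleton.elim _ _⟩
    exact iteratedFDeriv_one_apply _

/-- The Euler–Lagrange equations of a first-order Lagrangian, in terms of its partial derivatives
`P` in the field and `Q` in the gradient of the field. -/
theorem solvesEOM_of_hasDerivAt {L : Lagrangian d 1 V} {g : SymTensor d} {Ω : Set (Fin d → ℝ)}
    (hΩ : IsOpen Ω) {φ : (Fin d → ℝ) → V} (hL : Differentiable ℝ fun j : Jet d 1 V => L (g, j))
    (P : (Fin d → ℝ) → V → ℝ) (Q : Fin d → (Fin d → ℝ) → V → ℝ)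
    (hP : ∀ x ∈ Ω, ∀ v, HasDerivAt (fun t : ℝ => L (g, firstJet (φ x + t • v)
      fun μ => fderiv ℝ φ x (Pi.single μ 1))) (P x v) 0)
    (hQ : ∀ x ∈ Ω, ∀ μ v, HasDerivAt (fun t : ℝ => L (g, firstJet (φ x)
      ((fun μ => fderiv ℝ φ x (Pi.single μ 1)) + t • (Pi.single μ v : Fin d → V)))) (Q μ x v) 0)
    (hPQ : ∀ x ∈ Ω, ∀ v, P x v = ∑ μ, fderiv ℝ (fun y => Q μ y v) x (Pi.single μ 1)) :
    SolvesEOM L g Ω φ := by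
  intro x hx v
  rw [eulerLagrange_one, sub_eq_zero]
  have h0 : fderiv ℝ (fun j : Jet d 1 V => L (g, j)) (jet 1 φ x)
        (Pi.single (0 : Fin 2) (Pi.single (fun i => i.elim0) v)) = P x v := by
    refine fderiv_apply_of_hasDerivAt_line hL.differentiableAt ?_
    simp only [jet_one_eq, firstJet_add_smul_value]
    exact hP x hx v
  rw [h0, hPQ x hx v]
  refine Finset.sum_congr rfl fun μ _ => ?_
  have he : (fun y => fderiv ℝ (fun j : Jet d 1 V => L (g, j)) (jet 1 φ y)
      (Pi.single (1 : Fin 2) (Pi.single (fun _ => μ) v))) =ᶠ[𝓝 x] fun y => Q μ y v := by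
    filter_upwards [hΩ.mem_nhds hx] with y hy
    refine fderiv_apply_of_hasDerivAt_line hL.differentiableAt ?_
    simp only [jet_one_eq, firstJet_add_smul_deriv]
    exact hQ y hy μ v
  rw [he.fderiv_eq]

theorem inv_euclideanMetric (d : ℕ) : (Matrix.of (euclideanMetric d).1)⁻¹ = 1 := by
  have : Matrix.of (euclideanMetric d).1 = 1 := by
    ext i j; simp [euclideanMetric, Matrix.one_apply]
  rw [this, inv_one]

theorem stress_euclidean_eq_zero {d r : ℕ} {V : Type*} {L : Lagrangian d r V} {j : Jet d r V}
    (hL : Differentiable ℝ fun g : SymTensor d => L (g, j)) (c : Fin d → Fin d → ℝ)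
    (hc : ∀ μ ν, HasDerivAt (fun t : ℝ => L (euclideanMetric d + t • metricDirection μ ν, j))
      (c μ ν) 0)
    (h : ∀ μ ν, -2 * c μ ν + (if μ = ν then 1 else 0) * L (euclideanMetric d, j) = 0) :
    stress L (euclideanMetric d, j) = 0 := by
  refine Subtype.ext (funext fun μ => funext fun ν => ?_)
  have := fderiv_apply_of_hasDerivAt_line (E := SymTensor d) hL.differentiableAt (hc μ ν)
  simp only [stress, this, inv_euclideanMetric, Matrix.one_apply]
  exact h μ ν

theorem contDiff_value : ContDiff ℝ ∞ (fun j : Jet d 1 V => j.value) := by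
  exact contDiff_pi.1 (contDiff_pi.1 contDiff_id (0 : Fin 2)) _

theorem contDiff_deriv (μ : Fin d) : ContDiff ℝ ∞ (fun j : Jet d 1 V => j.deriv μ) := by
  exact ((ContinuousLinearMap.proj (R := ℝ) (φ := fun _ : Fin 1 → Fin d => V) fun _ => μ).comp
    (ContinuousLinearMap.proj (R := ℝ) (φ := fun k : Fin 2 => (Fin k → Fin d) → V) 1)).contDiff

theorem fderiv_fderiv_comm {E F : Type*} [NormedAddCommGroup E] [NormedSpace ℝ E]
    [NormedAddCommGroup F] [NormedSpace ℝ F] {Ω : Set E} {φ : E → F} (hΩ : IsOpen Ω)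
    (hφ : ContDiffOn ℝ ∞ φ Ω) {x : E} (hx : x ∈ Ω) (v w : E) :
    fderiv ℝ (fderiv ℝ φ) x v w = fderiv ℝ (fderiv ℝ φ) x w v :=
  ((hφ.contDiffAt (hΩ.mem_nhds hx)).isSymmSndFDerivAt
    (by rw [minSmoothness_of_isRCLikeNormedField]
        exact WithTop.coe_le_coe.2 (le_top : (2 : ℕ∞) ≤ ⊤))).eq v w

theorem hasDerivAt_fderiv_line {E F : Type*} [NormedAddCommGroup E] [NormedSpace ℝ E]
    [NormedAddCommGroup F] [NormedSpace ℝ F] {Ω : Set E} {φ : E → F} (hΩ : IsOpen Ω)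
    (hφ : ContDiffOn ℝ ∞ φ Ω) {x : E} (hx : x ∈ Ω) (e v : E) :
    HasDerivAt (fun t : ℝ => fderiv ℝ φ (x + t • e) v) (fderiv ℝ (fderiv ℝ φ) x e v) 0 := by
  have hd := hasDerivAt_line e
    (((contDiffOn_fderiv_smooth hΩ hφ).contDiffAt (hΩ.mem_nhds hx)).differentiableAt (by simp))
  exact (ContinuousLinearMap.apply ℝ F v).hasFDerivAt.comp_hasDerivAt 0 hd

end FirstOrder

/-! ### Instantons of the projective sigma model -/

section ProjectiveModel

variable {N : ℕ}

theorem HasDerivAt.star_dotProduct {a b : ℝ → Fin N → ℂ} {a' b' : Fin N → ℂ} {t : ℝ}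
    (ha : HasDerivAt a a' t) (hb : HasDerivAt b b' t) :
    HasDerivAt (fun t => star (a t) ⬝ᵥ b t) (star a' ⬝ᵥ b t + star (a t) ⬝ᵥ b') t := by
  simp only [dotProduct, ← Finset.sum_add_distrib]
  exact HasDerivAt.fun_sum fun i _ => (hasDerivAt_pi.1 ha i).star.mul (hasDerivAt_pi.1 hb i)

theorem HasDerivAt.complex_re {z : ℝ → ℂ} {z' : ℂ} {t : ℝ} (h : HasDerivAt z z' t) :
    HasDerivAt (fun t => (z t).re) z'.re t :=
  Complex.reCLM.hasFDerivAt.comp_hasDerivAt t h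

theorem ContDiffOn.star_dotProduct {E : Type*} [NormedAddCommGroup E] [NormedSpace ℝ E]
    {S : Set E} {a b : E → Fin N → ℂ} (ha : ContDiffOn ℝ ∞ a S) (hb : ContDiffOn ℝ ∞ b S) :
    ContDiffOn ℝ ∞ (fun x => star (a x) ⬝ᵥ b x) S :=
  ContDiffOn.sum fun i _ =>
    (Complex.conjCLE.contDiff.comp_contDiffOn (contDiffOn_pi.1 ha i)).mul (contDiffOn_pi.1 hb i)

theorem star_dotProduct_comm (a b : Fin N → ℂ) : star (star a ⬝ᵥ b) = star b ⬝ᵥ a := by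
  exact (Matrix.star_dotProduct b a).symm

theorem HasDerivAt.re_star_dotProduct_self {c : ℝ → Fin N → ℂ} {c' : Fin N → ℂ} {t : ℝ}
    (hc : HasDerivAt c c' t) :
    HasDerivAt (fun t => (star (c t) ⬝ᵥ c t).re) (2 * (star (c t) ⬝ᵥ c').re) t := by
  convert (hc.star_dotProduct hc).complex_re using 1
  rw [Complex.add_re, ← star_dotProduct_comm (c t) c', Complex.star_def, Complex.conj_re, two_mul]

/-- The composite connection `i A_μ = i (i/2) ((∂_μ φ)† φ - φ† ∂_μ φ)`. -/
noncomputable def cpConnection (u w : Fin N → ℂ) : ℂ :=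
  Complex.I * (Complex.I / 2 * (star w ⬝ᵥ u - star u ⬝ᵥ w))

theorem cpCovariant_eq (u w : Fin N → ℂ) : cpCovariant u w = w - cpConnection u w • u := rfl

theorem cpConnection_eq (u w : Fin N → ℂ) :
    cpConnection u w = -(star w ⬝ᵥ u - star u ⬝ᵥ w) / 2 := by
  unfold cpConnection
  linear_combination ((star w ⬝ᵥ u - star u ⬝ᵥ w) / 2) * Complex.I_mul_I

theorem star_cpConnection (u w : Fin N → ℂ) : star (cpConnection u w) = -cpConnection u w := by
  rw [cpConnection_eq, star_div₀, star_neg, star_sub, star_dotProduct_comm, star_dotProduct_comm,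
    show star (2 : ℂ) = 2 from star_ofNat 2]
  ring

theorem HasDerivAt.cpConnection {u w : ℝ → Fin N → ℂ} {u' w' : Fin N → ℂ} {t : ℝ}
    (hu : HasDerivAt u u' t) (hw : HasDerivAt w w' t) :
    HasDerivAt (fun t => cpConnection (u t) (w t))
      (-((star w' ⬝ᵥ u t + star (w t) ⬝ᵥ u') - (star u' ⬝ᵥ w t + star (u t) ⬝ᵥ w')) / 2) t := by
  simp only [cpConnection_eq]
  exact ((hw.star_dotProduct hu).sub (hu.star_dotProduct hw)).neg.div_const 2

theorem HasDerivAt.cpCovariant {u w : ℝ → Fin N → ℂ} {u' w' : Fin N → ℂ} {t : ℝ}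
    (hu : HasDerivAt u u' t) (hw : HasDerivAt w w' t) :
    HasDerivAt (fun t => cpCovariant (u t) (w t))
      (w' - (_root_.cpConnection (u t) (w t) • u' +
        (-((star w' ⬝ᵥ u t + star (w t) ⬝ᵥ u') -
          (star u' ⬝ᵥ w t + star (u t) ⬝ᵥ w')) / 2) • u t)) t := by
  simp only [cpCovariant_eq]
  exact hw.sub ((hu.cpConnection hw).smul hu)

theorem ContDiffOn.cpCovariant {E : Type*} [NormedAddCommGroup E] [NormedSpace ℝ E]
    {S : Set E} {u w : E → Fin N → ℂ} (hu : ContDiffOn ℝ ∞ u S) (hw : ContDiffOn ℝ ∞ w S) :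
    ContDiffOn ℝ ∞ (fun x => cpCovariant (u x) (w x)) S := by
  simp only [cpCovariant_eq, cpConnection_eq]
  exact hw.sub ((((hw.star_dotProduct hu).sub (hu.star_dotProduct hw)).neg.div_const 2).smul hu)

/-- On tangent vectors to the unit sphere the connection equals u†w, so the covariant derivative is
the projection of w orthogonal to u. -/
theorem star_cpCovariant_dotProduct {u w : Fin N → ℂ} (hu : star u ⬝ᵥ u = 1)
    (hw : star w ⬝ᵥ u + star u ⬝ᵥ w = 0) : star (cpCovariant u w) ⬝ᵥ u = 0 := by
  rw [cpCovariant_eq, star_sub, star_smul, star_cpConnection, sub_dotProduct, smul_dotProduct, hu,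
    cpConnection_eq, smul_eq_mul]
  linear_combination hw / 2

theorem cpLagrangian_euclidean (U : (Fin N → ℂ) × ℝ) (w : Fin 2 → (Fin N → ℂ) × ℝ) :
    cpLagrangian N (euclideanMetric 2, firstJet U w) =
      ∑ μ, (star (cpCovariant U.1 (w μ).1) ⬝ᵥ cpCovariant U.1 (w μ).1).re -
        U.2 * ((star U.1 ⬝ᵥ U.1).re - 1) := by
  simp [cpLagrangian, euclideanMetric]

theorem contDiffOn_value_fst {N : ℕ} :
    ContDiffOn ℝ ∞ (fun j : Jet 2 1 ((Fin N → ℂ) × ℝ) => j.value.1) Set.univ :=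
  (contDiff_fst.comp contDiff_value).contDiffOn

theorem differentiable_cpLagrangian (g : SymTensor 2) :
    Differentiable ℝ fun j : Jet 2 1 ((Fin N → ℂ) × ℝ) => cpLagrangian N (g, j) := by
  have hu := contDiffOn_value_fst (N := N)
  have hc : ∀ μ, ContDiffOn ℝ ∞ (fun j : Jet 2 1 ((Fin N → ℂ) × ℝ) =>
      cpCovariant j.value.1 (j.deriv μ).1) Set.univ := fun μ =>
    hu.cpCovariant (contDiff_fst.comp (contDiff_deriv μ)).contDiffOn
  have h : ContDiffOn ℝ ∞ (fun j : Jet 2 1 ((Fin N → ℂ) × ℝ) => cpLagrangian N (g, j))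
      Set.univ := by
    simp only [cpLagrangian]
    exact (ContDiffOn.sum fun μ _ => ContDiffOn.sum fun ν _ => contDiffOn_const.mul
      (Complex.reCLM.contDiff.comp_contDiffOn ((hc μ).star_dotProduct (hc ν)))).sub
      ((contDiff_snd.comp contDiff_value).contDiffOn.mul
        ((Complex.reCLM.contDiff.comp_contDiffOn (hu.star_dotProduct hu)).sub contDiffOn_const))
  exact (contDiffOn_univ.1 h).differentiable (by simp)

theorem differentiable_cpLagrangian_metric (j : Jet 2 1 ((Fin N → ℂ) × ℝ)) :
    Differentiable ℝ fun g : SymTensor 2 => cpLagrangian N (g, j) := by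
  have h : ContDiff ℝ ∞ fun g : SymTensor 2 => cpLagrangian N (g, j) := by
    simp only [cpLagrangian]
    exact (ContDiff.sum fun μ _ => ContDiff.sum fun ν _ =>
      (contDiff_component μ ν).mul contDiff_const).sub contDiff_const
  exact h.differentiable (by simp)

/-- The variation of the composite connection contributes a multiple of φ, which is orthogonal to
Dφ; the variation of the multiplier drops out because the constraint holds. Hence A may be varied as
if it were fixed. -/
theorem hasDerivAt_cpLagrangian {U : (Fin N → ℂ) × ℝ} {w : Fin 2 → (Fin N → ℂ) × ℝ}
    (hu : star U.1 ⬝ᵥ U.1 = 1) (hw : ∀ μ, star (w μ).1 ⬝ᵥ U.1 + star U.1 ⬝ᵥ (w μ).1 = 0)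
    (δU : (Fin N → ℂ) × ℝ) (δw : Fin 2 → (Fin N → ℂ) × ℝ) :
    HasDerivAt (fun t : ℝ => cpLagrangian N (euclideanMetric 2, firstJet (U + t • δU) (w + t • δw)))
      (∑ μ, 2 * (star (cpCovariant U.1 (w μ).1) ⬝ᵥ
        ((δw μ).1 - cpConnection U.1 (w μ).1 • δU.1)).re - U.2 * (2 * (star U.1 ⬝ᵥ δU.1).re)) 0 := by
  simp only [cpLagrangian_euclidean]
  have hline : ∀ {F : Type} [NormedAddCommGroup F] [NormedSpace ℝ F] (a b : F),
      HasDerivAt (fun t : ℝ => a + t • b) b 0 := fun a b => by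
    simpa using ((hasDerivAt_id (0 : ℝ)).smul_const b).const_add a
  have hU : HasDerivAt (fun t : ℝ => (U + t • δU).1) δU.1 0 := hline U.1 δU.1
  have hU2 : HasDerivAt (fun t : ℝ => (U + t • δU).2) δU.2 0 := by
    simpa using hline U.2 δU.2
  have hW : ∀ μ, HasDerivAt (fun t : ℝ => ((w + t • δw) μ).1) (δw μ).1 0 := fun μ =>
    hline (w μ).1 (δw μ).1
  have h := (HasDerivAt.fun_sum (u := Finset.univ) fun μ _ =>
    (hU.cpCovariant (hW μ)).re_star_dotProduct_self).sub
      (hU2.mul (hU.re_star_dotProduct_self.sub_const 1))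
  refine h.congr_deriv (Eq.symm ?_)
  simp only [zero_smul, add_zero, hu, Complex.one_re, sub_self, mul_zero, zero_add]
  congr 1
  refine Finset.sum_congr rfl fun μ _ => ?_
  simp only [dotProduct_sub, dotProduct_add, dotProduct_smul,
    star_cpCovariant_dotProduct hu (hw μ), smul_zero, add_zero]

theorem leviCivita_two : leviCivita ![(0 : Fin 2), 1] = 1 ∧ leviCivita ![(1 : Fin 2), 0] = -1 ∧
    leviCivita ![(0 : Fin 2), 0] = 0 ∧ leviCivita ![(1 : Fin 2), 1] = 0 := by
  simp [leviCivita, Matrix.det_fin_two]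

theorem star_smul_dotProduct_eq (z : ℂ) (a b : Fin N → ℂ) :
    star (z • a) ⬝ᵥ b = star a ⬝ᵥ (star z • b) := by
  rw [star_smul, smul_dotProduct, dotProduct_smul]

variable {s : ℝ} {Ω : Set (Fin 2 → ℝ)} {φ : (Fin 2 → ℝ) → Fin N → ℂ}

theorem IsCPInstanton.tangent (h : IsCPInstanton s Ω φ) (hΩ : IsOpen Ω) {x : Fin 2 → ℝ}
    (hx : x ∈ Ω) (e : Fin 2 → ℝ) :
    star (fderiv ℝ φ x e) ⬝ᵥ φ x + star (φ x) ⬝ᵥ fderiv ℝ φ x e = 0 := by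
  have hd := hasDerivAt_line e
    ((h.smooth.contDiffAt (hΩ.mem_nhds hx)).differentiableAt (by simp))
  have h1 := hd.star_dotProduct hd
  have hmem : ∀ᶠ t : ℝ in 𝓝 0, x + t • e ∈ Ω := by
    have hc : ContinuousAt (fun t : ℝ => x + t • e) 0 := by fun_prop
    exact hc.eventually (by simpa using hΩ.mem_nhds hx)
  have h2 := (hasDerivAt_const (0 : ℝ) (1 : ℂ)).congr_of_eventuallyEq
    (hmem.mono fun t ht => h.unit _ ht)
  simpa using h1.unique h2

theorem IsCPInstanton.covariant_one (h : IsCPInstanton s Ω φ)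
    {x : Fin 2 → ℝ} (hx : x ∈ Ω) :
    cpCovariant (φ x) (fderiv ℝ φ x (Pi.single 1 1)) =
      (s * Complex.I) • cpCovariant (φ x) (fderiv ℝ φ x (Pi.single 0 1)) := by
  have h1 := h.chiral x hx 1
  rw [Fin.sum_univ_two, leviCivita_two.2.1, leviCivita_two.2.2.2] at h1
  rw [← sub_eq_zero, ← h1]
  ext i
  simp
  ring

theorem IsCPInstanton.covariant_zero (h : IsCPInstanton s Ω φ)
    {x : Fin 2 → ℝ} (hx : x ∈ Ω) :
    cpCovariant (φ x) (fderiv ℝ φ x (Pi.single 0 1)) =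
      (-(s * Complex.I)) • cpCovariant (φ x) (fderiv ℝ φ x (Pi.single 1 1)) := by
  have h1 := h.chiral x hx 0
  rw [Fin.sum_univ_two, leviCivita_two.1, leviCivita_two.2.2.1] at h1
  rw [← sub_eq_zero, ← h1]
  ext i
  simp

/-- The Lagrange multiplier of a `ℂP^{N-1}` (anti-)instanton. -/
noncomputable def cpMultiplier (s : ℝ) (φ : (Fin 2 → ℝ) → Fin N → ℂ) (x : Fin 2 → ℝ) : ℝ :=
  2 * s * (star (fderiv ℝ φ x (Pi.single 0 1)) ⬝ᵥ fderiv ℝ φ x (Pi.single 1 1)).im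

theorem IsCPInstanton.contDiffOn_fderiv (h : IsCPInstanton s Ω φ) (hΩ : IsOpen Ω)
    (e : Fin 2 → ℝ) : ContDiffOn ℝ ∞ (fun x => fderiv ℝ φ x e) Ω :=
  (contDiffOn_fderiv_smooth hΩ h.smooth).clm_apply contDiffOn_const

theorem IsCPInstanton.contDiffOn_multiplier (h : IsCPInstanton s Ω φ) (hΩ : IsOpen Ω) :
    ContDiffOn ℝ ∞ (cpMultiplier s φ) Ω :=
  contDiffOn_const.mul (Complex.imCLM.contDiff.comp_contDiffOn
    ((h.contDiffOn_fderiv hΩ _).star_dotProduct (h.contDiffOn_fderiv hΩ _)))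

theorem IsCPInstanton.fderiv_pair (h : IsCPInstanton s Ω φ) (hΩ : IsOpen Ω) {x : Fin 2 → ℝ}
    (hx : x ∈ Ω) (e : Fin 2 → ℝ) :
    (fderiv ℝ (fun x => (φ x, cpMultiplier s φ x)) x e).1 = fderiv ℝ φ x e := by
  have h1 := (h.smooth.contDiffAt (hΩ.mem_nhds hx)).differentiableAt (by simp)
  have h2 := ((h.contDiffOn_multiplier hΩ).contDiffAt (hΩ.mem_nhds hx)).differentiableAt (by simp)
  rw [h1.fderiv_prodMk h2]
  rfl

/-- Multiplication by s·i preserves the norm and makes a vector orthogonal to itself for the real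
inner product. The real Gram matrix of D₀φ and D₁φ is therefore a multiple of the identity, which
the trace term cancels in two dimensions. -/
theorem IsCPInstanton.stressVanishes (h : IsCPInstanton s Ω φ) (hs : s = 1 ∨ s = -1)
    (hΩ : IsOpen Ω) : StressVanishes (cpLagrangian N) (euclideanMetric 2) Ω
      (fun x => (φ x, cpMultiplier s φ x)) := by
  intro x hx
  have hs2 : s * s = 1 := by rcases hs with rfl | rfl <;> norm_num
  rw [jet_one_eq]
  set c : Fin 2 → Fin N → ℂ := fun μ => cpCovariant (φ x) (fderiv ℝ φ x (Pi.single μ 1)) with hc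
  refine stress_euclidean_eq_zero (differentiable_cpLagrangian_metric _)
    (fun μ ν => ∑ a, ∑ b, (metricDirection μ ν).1 a b * (star (c a) ⬝ᵥ c b).re)
    (fun μ ν => ?_) fun μ ν => ?_
  · simp only [cpLagrangian, firstJet_value, firstJet_deriv, h.fderiv_pair hΩ hx]
    refine (HasDerivAt.fun_sum fun a _ => HasDerivAt.fun_sum fun b _ =>
      HasDerivAt.mul_const ?_ _).sub_const _
    simpa using ((hasDerivAt_id (0 : ℝ)).mul_const ((metricDirection μ ν).1 a b)).const_add
      ((euclideanMetric 2).1 a b)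
  · have h1 : c 1 = (s * Complex.I) • c 0 := h.covariant_one hx
    have him : (star (c 0) ⬝ᵥ c 0).im = 0 := by
      rw [← Complex.conj_eq_iff_im, ← Complex.star_def, star_dotProduct_comm]
    have h01 : (star (c 0) ⬝ᵥ c 1).re = 0 := by
      rw [h1, dotProduct_smul]; simp [him]
    have h10 : (star (c 1) ⬝ᵥ c 0).re = 0 := by
      rw [← star_dotProduct_comm]; simpa using h01
    have h11 : (star (c 1) ⬝ᵥ c 1).re = (star (c 0) ⬝ᵥ c 0).re := by
      rw [h1, star_smul_dotProduct_eq, smul_smul, dotProduct_smul]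
      simp [him, hs2]
    rw [cpLagrangian_euclidean]
    simp only [h.fderiv_pair hΩ hx, h.unit x hx, Complex.one_re, sub_self, mul_zero, sub_zero]
    change _ + _ * (∑ μ, (star (c μ) ⬝ᵥ c μ).re) = 0
    simp only [Fin.sum_univ_two, h01, h10, h11]
    fin_cases μ <;> fin_cases ν <;> simp [metricDirection] <;> ring

theorem fderiv_re_star_smul_dotProduct {E : Type*} [NormedAddCommGroup E] [NormedSpace ℝ E]
    {S : Set E} (hS : IsOpen S) {c : E → Fin N → ℂ} (hc : ContDiffOn ℝ ∞ c S) {x : E} (hx : x ∈ S)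
    (e : E) (z : ℂ) (v : Fin N → ℂ) :
    fderiv ℝ (fun y => 2 * (star (z • c y) ⬝ᵥ v).re) x e =
      2 * (star (z • fderiv ℝ c x e) ⬝ᵥ v).re := by
  have hz : ContDiffOn ℝ ∞ (fun y => z • c y) S := hc.const_smul z
  have h1 : ContDiffOn ℝ ∞ (fun y => star (z • c y) ⬝ᵥ v) S :=
    hz.star_dotProduct contDiffOn_const
  have h2 : ContDiffOn ℝ ∞ (fun y => 2 * (star (z • c y) ⬝ᵥ v).re) S :=
    contDiffOn_const.mul (Complex.reCLM.contDiff.comp_contDiffOn h1)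
  have hd : HasDerivAt (fun t : ℝ => c (x + t • e)) (fderiv ℝ c x e) 0 :=
    hasDerivAt_line e ((hc.contDiffAt (hS.mem_nhds hx)).differentiableAt (by simp))
  have hd' : HasDerivAt (fun t : ℝ => z • c (x + t • e)) (z • fderiv ℝ c x e) 0 :=
    hd.const_smul z
  have h3 := hd'.star_dotProduct (hasDerivAt_const (0 : ℝ) v)
  rw [dotProduct_zero, add_zero] at h3
  exact fderiv_apply_of_hasDerivAt_line
    ((h2.contDiffAt (hS.mem_nhds hx)).differentiableAt (by simp)) (h3.complex_re.const_mul 2)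

theorem IsCPInstanton.contDiffOn_covariant (h : IsCPInstanton s Ω φ) (hΩ : IsOpen Ω)
    (e : Fin 2 → ℝ) : ContDiffOn ℝ ∞ (fun x => cpCovariant (φ x) (fderiv ℝ φ x e)) Ω :=
  h.smooth.cpCovariant (h.contDiffOn_fderiv hΩ e)

theorem IsCPInstanton.fderiv_covariant (h : IsCPInstanton s Ω φ) (hΩ : IsOpen Ω)
    {x : Fin 2 → ℝ} (hx : x ∈ Ω) (e f : Fin 2 → ℝ) :
    fderiv ℝ (fun x => cpCovariant (φ x) (fderiv ℝ φ x e)) x f =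
      fderiv ℝ (fderiv ℝ φ) x f e - (cpConnection (φ x) (fderiv ℝ φ x e) • fderiv ℝ φ x f +
        (-((star (fderiv ℝ (fderiv ℝ φ) x f e) ⬝ᵥ φ x + star (fderiv ℝ φ x e) ⬝ᵥ fderiv ℝ φ x f) -
          (star (fderiv ℝ φ x f) ⬝ᵥ fderiv ℝ φ x e +
            star (φ x) ⬝ᵥ fderiv ℝ (fderiv ℝ φ) x f e)) / 2) • φ x) := by
  have hφ : HasDerivAt (fun t : ℝ => φ (x + t • f)) (fderiv ℝ φ x f) 0 :=
    hasDerivAt_line f ((h.smooth.contDiffAt (hΩ.mem_nhds hx)).differentiableAt (by simp))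
  refine fderiv_apply_of_hasDerivAt_line
    (((h.contDiffOn_covariant hΩ e).contDiffAt (hΩ.mem_nhds hx)).differentiableAt (by simp)) ?_
  have := hφ.cpCovariant (hasDerivAt_fderiv_line hΩ h.smooth hx f e)
  simp only [zero_smul, add_zero] at this
  exact this

/-- The covariant divergence of the covariant derivative of an instanton is a multiple of it. -/
theorem IsCPInstanton.covariant_divergence (h : IsCPInstanton s Ω φ) (hΩ : IsOpen Ω)
    {x : Fin 2 → ℝ} (hx : x ∈ Ω) {c : Fin 2 → (Fin 2 → ℝ) → Fin N → ℂ}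
    (hc : ∀ μ, c μ = fun x => cpCovariant (φ x) (fderiv ℝ φ x (Pi.single μ 1))) {a : Fin 2 → ℂ}
    (ha : ∀ μ, a μ = cpConnection (φ x) (fderiv ℝ φ x (Pi.single μ 1))) :
    a 0 • c 0 x + a 1 • c 1 x - (cpMultiplier s φ x : ℂ) • φ x =
      (-(s * Complex.I)) • fderiv ℝ (c 1) x (Pi.single 0 1) +
        (s * Complex.I) • fderiv ℝ (c 0) x (Pi.single 1 1) := by
  have h1 : c 1 x = (s * Complex.I) • c 0 x := by
    rw [hc, hc]; exact h.covariant_one hx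
  have h0 : c 0 x = (-(s * Complex.I)) • c 1 x := by
    rw [hc, hc]; exact h.covariant_zero hx
  have hd0 : c 0 x = fderiv ℝ φ x (Pi.single 0 1) - a 0 • φ x := by
    rw [hc, ha]; rfl
  have hd1 : c 1 x = fderiv ℝ φ x (Pi.single 1 1) - a 1 • φ x := by
    rw [hc, ha]; rfl
  have e1 : fderiv ℝ (c 1) x (Pi.single 0 1) = _ :=
    hc 1 ▸ h.fderiv_covariant hΩ hx (Pi.single 1 1) (Pi.single 0 1)
  have e0 : fderiv ℝ (c 0) x (Pi.single 1 1) = _ :=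
    hc 0 ▸ h.fderiv_covariant hΩ hx (Pi.single 0 1) (Pi.single 1 1)
  rw [e1, e0, fderiv_fderiv_comm hΩ h.smooth hx (Pi.single 1 1) (Pi.single 0 1), ← ha, ← ha]
  -- The bracket is the curvature ∂₀a₁ - ∂₁a₀ of the composite connection; the multiplier is chosen
  -- to absorb its φ-component.
  have hlam : (cpMultiplier s φ x : ℂ) = -(s * Complex.I) *
      (star (fderiv ℝ φ x (Pi.single 0 1)) ⬝ᵥ fderiv ℝ φ x (Pi.single 1 1) -
        star (fderiv ℝ φ x (Pi.single 1 1)) ⬝ᵥ fderiv ℝ φ x (Pi.single 0 1)) := by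
    rw [← star_dotProduct_comm (fderiv ℝ φ x (Pi.single 0 1)), Complex.star_def, Complex.sub_conj,
      cpMultiplier]
    push_cast
    linear_combination (2 * (s : ℂ) * ((star (fderiv ℝ φ x (Pi.single 0 1)) ⬝ᵥ
      fderiv ℝ φ x (Pi.single 1 1)).im : ℂ)) * Complex.I_mul_I
  rw [hlam]
  generalize (star (fderiv ℝ φ x (Pi.single 0 1)) ⬝ᵥ fderiv ℝ φ x (Pi.single 1 1)) = q
  generalize (star (fderiv ℝ φ x (Pi.single 1 1)) ⬝ᵥ fderiv ℝ φ x (Pi.single 0 1)) = q'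
  -- After symmetry of the second derivative, k and k' occur equally in both covariant derivatives
  -- and cancel; their values are irrelevant.
  generalize (star (fderiv ℝ (fderiv ℝ φ) x (Pi.single 0 1) (Pi.single 1 1)) ⬝ᵥ φ x) = k
  generalize (star (φ x) ⬝ᵥ fderiv ℝ (fderiv ℝ φ) x (Pi.single 0 1) (Pi.single 1 1)) = k'
  ext i
  have h0i := congrFun h0 i
  have h1i := congrFun h1 i
  have hd0i := congrFun hd0 i
  have hd1i := congrFun hd1 i
  simp only [Pi.add_apply, Pi.sub_apply, Pi.smul_apply, smul_eq_mul] at *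
  linear_combination a 0 * h0i + a 1 * h1i - a 0 * (s * Complex.I) * hd1i +
    a 1 * (s * Complex.I) * hd0i

theorem IsCPInstanton.solvesEOM (h : IsCPInstanton s Ω φ)
    (hΩ : IsOpen Ω) : SolvesEOM (cpLagrangian N) (euclideanMetric 2) Ω
      (fun x => (φ x, cpMultiplier s φ x)) := by
  set c : Fin 2 → (Fin 2 → ℝ) → Fin N → ℂ :=
    fun μ x => cpCovariant (φ x) (fderiv ℝ φ x (Pi.single μ 1)) with hc
  set a : Fin 2 → (Fin 2 → ℝ) → ℂ :=
    fun μ x => cpConnection (φ x) (fderiv ℝ φ x (Pi.single μ 1)) with ha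
  have hgen := fun x (hx : x ∈ Ω) => hasDerivAt_cpLagrangian
    (U := (φ x, cpMultiplier s φ x))
    (w := fun μ => fderiv ℝ (fun x => (φ x, cpMultiplier s φ x)) x (Pi.single μ 1))
    (h.unit x hx) fun μ => by simpa only [h.fderiv_pair hΩ hx] using h.tangent hΩ hx (Pi.single μ 1)
  refine solvesEOM_of_hasDerivAt hΩ (differentiable_cpLagrangian _)
    (fun x v => ∑ μ, 2 * (star (c μ x) ⬝ᵥ (-(a μ x • v.1))).re -
      cpMultiplier s φ x * (2 * (star (φ x) ⬝ᵥ v.1).re))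
    -- The momentum 2 D_μφ is rewritten by duality through the other component, so that its
    -- divergence becomes a curl.
    (fun μ x v => 2 * (star ((if μ = 0 then -(s * Complex.I) else s * Complex.I) •
      c (if μ = 0 then 1 else 0) x) ⬝ᵥ v.1).re) (fun x hx v => ?_) (fun x hx μ v => ?_)
    fun x hx v => ?_
  · have := hgen x hx v 0
    simpa only [smul_zero, add_zero, Pi.zero_apply, Prod.fst_zero, zero_sub,
      h.fderiv_pair hΩ hx] using this
  · have := hgen x hx 0 (Pi.single μ v)
    simp only [smul_zero, add_zero, Prod.fst_zero, sub_zero, dotProduct_zero, Complex.zero_re,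
      mul_zero, h.fderiv_pair hΩ hx] at this
    refine this.congr_deriv ?_
    rw [Finset.sum_eq_single μ (fun ν _ hν => by simp [hν]) (by simp), Pi.single_eq_same]
    congr 4
    fin_cases μ
    · exact h.covariant_zero hx
    · exact h.covariant_one hx
  · have hcs : ∀ μ, ContDiffOn ℝ ∞ (c μ) Ω := fun μ => h.contDiffOn_covariant hΩ _
    have hkey := h.covariant_divergence hΩ hx (c := c) (a := fun μ => a μ x) (fun _ => rfl)
      fun _ => rfl
    simp only [Fin.sum_univ_two, fderiv_re_star_smul_dotProduct hΩ (hcs _) hx]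
    have e : ∀ z : ℝ, ∀ b : Fin N → ℂ, z * (2 * (star b ⬝ᵥ v.1).re) =
        2 * (star ((z : ℂ) • b) ⬝ᵥ v.1).re := fun z b => by
      rw [star_smul_dotProduct_eq, dotProduct_smul]; simp; ring
    have e' : ∀ μ, star (c μ x) ⬝ᵥ (-(a μ x • v.1)) = star (a μ x • c μ x) ⬝ᵥ v.1 := fun μ => by
      rw [star_smul_dotProduct_eq, star_cpConnection, neg_smul]
    simp only [e, e', if_true, if_neg (one_ne_zero : (1 : Fin 2) ≠ 0)]
    have := congrArg (fun b => 2 * (star b ⬝ᵥ v.1).re) hkey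
    simp only [star_add, star_sub, add_dotProduct, sub_dotProduct, Complex.add_re,
      Complex.sub_re, mul_add, mul_sub] at this
    exact this

end ProjectiveModel

/-! ### The Levi-Civita symbol in four dimensions -/

section LeviCivita

/-- Integer determinants are decidable, which lets the kernel evaluate the symbol. -/
theorem leviCivita_eq_intCast {d : ℕ} (I : Fin d → Fin d) :
    leviCivita I =
      ((Matrix.det (Matrix.of fun a b => if I a = b then (1 : ℤ) else 0) : ℤ) : ℝ) := by
  rw [leviCivita, Int.cast_det]
  congr 1
  ext a b
  simp

theorem leviCivita_zero_one (ρ σ : Fin 4) : leviCivita ![0, 1, ρ, σ] =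
    ((if ρ = 2 ∧ σ = 3 then 1 else if ρ = 3 ∧ σ = 2 then -1 else 0 : ℤ) : ℝ) := by
  rw [leviCivita_eq_intCast]
  revert ρ σ
  have : ∀ ρ σ : Fin 4, Matrix.det (Matrix.of fun a b : Fin 4 =>
      if (![0, 1, ρ, σ] : Fin 4 → Fin 4) a = b then (1 : ℤ) else 0) =
      if ρ = 2 ∧ σ = 3 then 1 else if ρ = 3 ∧ σ = 2 then -1 else 0 := by decide +kernel
  exact fun ρ σ => congrArg _ (this ρ σ)

theorem leviCivita_zero_two (ρ σ : Fin 4) : leviCivita ![0, 2, ρ, σ] =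
    ((if ρ = 3 ∧ σ = 1 then 1 else if ρ = 1 ∧ σ = 3 then -1 else 0 : ℤ) : ℝ) := by
  rw [leviCivita_eq_intCast]
  revert ρ σ
  have : ∀ ρ σ : Fin 4, Matrix.det (Matrix.of fun a b : Fin 4 =>
      if (![0, 2, ρ, σ] : Fin 4 → Fin 4) a = b then (1 : ℤ) else 0) =
      if ρ = 3 ∧ σ = 1 then 1 else if ρ = 1 ∧ σ = 3 then -1 else 0 := by decide +kernel
  exact fun ρ σ => congrArg _ (this ρ σ)

theorem leviCivita_zero_three (ρ σ : Fin 4) : leviCivita ![0, 3, ρ, σ] =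
    ((if ρ = 1 ∧ σ = 2 then 1 else if ρ = 2 ∧ σ = 1 then -1 else 0 : ℤ) : ℝ) := by
  rw [leviCivita_eq_intCast]
  revert ρ σ
  have : ∀ ρ σ : Fin 4, Matrix.det (Matrix.of fun a b : Fin 4 =>
      if (![0, 3, ρ, σ] : Fin 4 → Fin 4) a = b then (1 : ℤ) else 0) =
      if ρ = 1 ∧ σ = 2 then 1 else if ρ = 2 ∧ σ = 1 then -1 else 0 := by decide +kernel
  exact fun ρ σ => congrArg _ (this ρ σ)

/-- The (anti-)self-duality equations of an antisymmetric tensor in components. -/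
theorem selfDual_components {s : ℝ} {F : Fin 4 → Fin 4 → ℝ} (hF : ∀ μ ν, F μ ν = -F ν μ)
    (h : ∀ μ ν, F μ ν = s / 2 * ∑ ρ, ∑ σ, leviCivita ![μ, ν, ρ, σ] * F ρ σ) :
    F 0 1 = s * F 2 3 ∧ F 0 2 = s * F 3 1 ∧ F 0 3 = s * F 1 2 := by
  refine ⟨?_, ?_, ?_⟩
  · rw [h 0 1]
    simp only [leviCivita_zero_one, Fin.sum_univ_four]
    simp [hF 3 2]; ring
  · rw [h 0 2]
    simp only [leviCivita_zero_two, Fin.sum_univ_four]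
    simp [hF 1 3]; ring
  · rw [h 0 3]
    simp only [leviCivita_zero_three, Fin.sum_univ_four]
    simp [hF 2 1]; ring

end LeviCivita

/-! ### The bracket of the gauge algebra and the field strength -/

section GaugeBracket

variable {m : ℕ} {c : Fin m → Fin m → Fin m → ℝ}

/-- The bracket of the gauge algebra with structure constants `c`. -/
def gaugeBracket (c : Fin m → Fin m → Fin m → ℝ) (X Y : Fin m → ℝ) : Fin m → ℝ :=
  fun a => ∑ b, ∑ e, c a b e * X b * Y e

theorem gaugeBracket_add_right (X Y Y' : Fin m → ℝ) :
    gaugeBracket c X (Y + Y') = gaugeBracket c X Y + gaugeBracket c X Y' := by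
  funext a
  simp only [gaugeBracket, Pi.add_apply, mul_add, Finset.sum_add_distrib]

theorem gaugeBracket_smul_right (r : ℝ) (X Y : Fin m → ℝ) :
    gaugeBracket c X (r • Y) = r • gaugeBracket c X Y := by
  funext a
  simp only [gaugeBracket, Pi.smul_apply, smul_eq_mul, Finset.mul_sum]
  exact Finset.sum_congr rfl fun b _ => Finset.sum_congr rfl fun e _ => by ring

theorem gaugeBracket_neg_right (X Y : Fin m → ℝ) :
    gaugeBracket c X (-Y) = -gaugeBracket c X Y := by
  simpa using gaugeBracket_smul_right (c := c) (-1) X Y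

theorem gaugeBracket_sub_right (X Y Y' : Fin m → ℝ) :
    gaugeBracket c X (Y - Y') = gaugeBracket c X Y - gaugeBracket c X Y' := by
  rw [sub_eq_add_neg, gaugeBracket_add_right, gaugeBracket_neg_right, ← sub_eq_add_neg]

theorem IsGaugeAlgebra.bracket_antisymm (hc : IsGaugeAlgebra c) (X Y : Fin m → ℝ) :
    gaugeBracket c X Y = -gaugeBracket c Y X := by
  funext a
  simp only [gaugeBracket, Pi.neg_apply, ← Finset.sum_neg_distrib]
  rw [Finset.sum_comm]
  exact Finset.sum_congr rfl fun e _ => Finset.sum_congr rfl fun b _ => by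
    rw [hc.antisymm_right a b e]; ring

/-- The inner sum over k isolates the coefficient that enters the Jacobi identity for the structure
constants. -/
theorem gaugeBracket_gaugeBracket (X Y Z : Fin m → ℝ) (l : Fin m) :
    gaugeBracket c (gaugeBracket c X Y) Z l =
      ∑ a, ∑ b, ∑ e, (∑ k, c k a b * c l k e) * (X a * Y b * Z e) := by
  have h : ∀ k e, c l k e * (∑ a, ∑ b, c k a b * X a * Y b) * Z e =
      ∑ a, ∑ b, c k a b * c l k e * (X a * Y b * Z e) := fun k e => by
    simp only [Finset.mul_sum, Finset.sum_mul]
    exact Finset.sum_congr rfl fun a _ => Finset.sum_congr rfl fun b _ => by ring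
  have h4 : ∀ T : Fin m → Fin m → Fin m → Fin m → ℝ,
      ∑ k, ∑ e, ∑ a, ∑ b, T k e a b = ∑ a, ∑ b, ∑ e, ∑ k, T k e a b := fun T => calc
    _ = ∑ e, ∑ k, ∑ a, ∑ b, T k e a b := Finset.sum_comm
    _ = ∑ e, ∑ a, ∑ k, ∑ b, T k e a b := Finset.sum_congr rfl fun _ _ => Finset.sum_comm
    _ = ∑ e, ∑ a, ∑ b, ∑ k, T k e a b := Finset.sum_congr rfl fun _ _ =>
        Finset.sum_congr rfl fun _ _ => Finset.sum_comm
    _ = ∑ a, ∑ e, ∑ b, ∑ k, T k e a b := Finset.sum_comm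
    _ = _ := Finset.sum_congr rfl fun _ _ => Finset.sum_comm
  simp only [gaugeBracket, h, Finset.sum_mul]
  exact h4 fun k e a b => c k a b * c l k e * (X a * Y b * Z e)

theorem IsGaugeAlgebra.bracket_jacobi (hc : IsGaugeAlgebra c) (X Y Z : Fin m → ℝ) :
    gaugeBracket c (gaugeBracket c X Y) Z + gaugeBracket c (gaugeBracket c Y Z) X +
      gaugeBracket c (gaugeBracket c Z X) Y = 0 := by
  funext l
  simp only [Pi.add_apply, Pi.zero_apply, gaugeBracket_gaugeBracket]
  have h3 : ∀ T : Fin m → Fin m → Fin m → ℝ, ∑ b, ∑ e, ∑ a, T a b e = ∑ a, ∑ b, ∑ e, T a b e :=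
    fun T => (Finset.sum_congr rfl fun _ _ => Finset.sum_comm).trans Finset.sum_comm
  -- The cyclic permutations are relabelled so that all three terms carry the same monomial X_a Y_b
  -- Z_e.
  rw [h3 fun a b e => (∑ k, c k b e * c l k a) * (Y b * Z e * X a),
    ← h3 fun e a b => (∑ k, c k e a * c l k b) * (Z e * X a * Y b)]
  simp only [← Finset.sum_add_distrib]
  refine Finset.sum_eq_zero fun a _ => Finset.sum_eq_zero fun b _ => Finset.sum_eq_zero fun e _ => ?_
  have := hc.jacobi a b e l
  simp only [Finset.sum_add_distrib] at this
  linear_combination (X a * Y b * Z e) * this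

/-- Invariance of the inner product under the adjoint action. -/
theorem IsGaugeAlgebra.dotProduct_bracket (hc : IsGaugeAlgebra c) (F X Y : Fin m → ℝ) :
    F ⬝ᵥ gaugeBracket c X Y = -(gaugeBracket c X F ⬝ᵥ Y) := by
  have h3 : ∀ T : Fin m → Fin m → Fin m → ℝ, ∑ a, ∑ b, ∑ e, T a b e = ∑ e, ∑ b, ∑ a, T a b e :=
    fun T => calc
      _ = ∑ a, ∑ e, ∑ b, T a b e := Finset.sum_congr rfl fun _ _ => Finset.sum_comm
      _ = ∑ e, ∑ a, ∑ b, T a b e := Finset.sum_comm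
      _ = _ := Finset.sum_congr rfl fun _ _ => Finset.sum_comm
  simp only [gaugeBracket, dotProduct, Finset.mul_sum, Finset.sum_mul, ← Finset.sum_neg_distrib]
  rw [h3]
  refine Finset.sum_congr rfl fun e _ => Finset.sum_congr rfl fun b _ =>
    Finset.sum_congr rfl fun a _ => ?_
  rw [hc.antisymm_left a b e, hc.antisymm_right b a e, hc.antisymm_left b e a]
  ring

theorem fieldStrength_eq (A : Fin 4 → Fin m → ℝ) (dA : Fin 4 → Fin 4 → Fin m → ℝ) (μ ν : Fin 4) :
    fieldStrength c A dA μ ν = dA μ ν - dA ν μ + gaugeBracket c (A μ) (A ν) := rfl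

theorem IsGaugeAlgebra.fieldStrength_antisymm (hc : IsGaugeAlgebra c) (A : Fin 4 → Fin m → ℝ)
    (dA : Fin 4 → Fin 4 → Fin m → ℝ) (μ ν : Fin 4) :
    fieldStrength c A dA μ ν = -fieldStrength c A dA ν μ := by
  rw [fieldStrength_eq, fieldStrength_eq, hc.bracket_antisymm (A μ)]
  abel

theorem HasDerivAt.gaugeBracket {X Y : ℝ → Fin m → ℝ} {X' Y' : Fin m → ℝ} {t : ℝ}
    (hX : HasDerivAt X X' t) (hY : HasDerivAt Y Y' t) :
    HasDerivAt (fun t => gaugeBracket c (X t) (Y t))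
      (_root_.gaugeBracket c X' (Y t) + _root_.gaugeBracket c (X t) Y') t := by
  refine hasDerivAt_pi.2 fun a => ?_
  simp only [_root_.gaugeBracket, Pi.add_apply, ← Finset.sum_add_distrib]
  exact HasDerivAt.fun_sum fun b _ => HasDerivAt.fun_sum fun e _ =>
    ((hasDerivAt_pi.1 hX b).const_mul (c a b e)).mul (hasDerivAt_pi.1 hY e)

theorem ContDiffOn.gaugeBracket {E : Type*} [NormedAddCommGroup E] [NormedSpace ℝ E] {S : Set E}
    {X Y : E → Fin m → ℝ} (hX : ContDiffOn ℝ ∞ X S) (hY : ContDiffOn ℝ ∞ Y S) :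
    ContDiffOn ℝ ∞ (fun x => gaugeBracket c (X x) (Y x)) S :=
  contDiffOn_pi.2 fun _ => ContDiffOn.sum fun b _ => ContDiffOn.sum fun e _ =>
    (contDiffOn_const.mul (contDiffOn_pi.1 hX b)).mul (contDiffOn_pi.1 hY e)

theorem HasDerivAt.fieldStrength {A : ℝ → Fin 4 → Fin m → ℝ} {A' : Fin 4 → Fin m → ℝ}
    {dA : ℝ → Fin 4 → Fin 4 → Fin m → ℝ} {dA' : Fin 4 → Fin 4 → Fin m → ℝ} {t : ℝ}
    (hA : ∀ μ, HasDerivAt (fun t => A t μ) (A' μ) t)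
    (hdA : ∀ μ ν, HasDerivAt (fun t => dA t μ ν) (dA' μ ν) t) (μ ν : Fin 4) :
    HasDerivAt (fun t => fieldStrength c (A t) (dA t) μ ν)
      (dA' μ ν - dA' ν μ + (_root_.gaugeBracket c (A' μ) (A t ν) +
        _root_.gaugeBracket c (A t μ) (A' ν))) t :=
  ((hdA μ ν).sub (hdA ν μ)).add ((hA μ).gaugeBracket (hA ν))

theorem ContDiffOn.fieldStrength {E : Type*} [NormedAddCommGroup E] [NormedSpace ℝ E] {S : Set E}
    {A : E → Fin 4 → Fin m → ℝ} {dA : E → Fin 4 → Fin 4 → Fin m → ℝ}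
    (hA : ∀ μ, ContDiffOn ℝ ∞ (fun x => A x μ) S)
    (hdA : ∀ μ ν, ContDiffOn ℝ ∞ (fun x => dA x μ ν) S) (μ ν : Fin 4) :
    ContDiffOn ℝ ∞ (fun x => fieldStrength c (A x) (dA x) μ ν) S :=
  ((hdA μ ν).sub (hdA ν μ)).add ((hA μ).gaugeBracket (hA ν))

end GaugeBracket

/-! ### Yang–Mills instantons -/

section YangMills

variable {m : ℕ} {c : Fin m → Fin m → Fin m → ℝ}

theorem trace_metricDirection {d : ℕ} (μ ν : Fin d) :
    ∑ α, (metricDirection μ ν).1 α α = if μ = ν then 1 else 0 := by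
  by_cases h : μ = ν
  · subst h
    simp [metricDirection]
  · rw [if_neg h]
    refine Finset.sum_eq_zero fun α _ => ?_
    have h1 : ¬(α = μ ∧ α = ν) := fun h' => h (h'.1.symm.trans h'.2)
    have h2 : ¬(α = ν ∧ α = μ) := fun h' => h (h'.2.symm.trans h'.1)
    simp only [metricDirection, if_neg h1, if_neg h2, add_zero, zero_div]

theorem ymLagrangian_euclidean (A : Fin 4 → Fin m → ℝ) (dA : Fin 4 → Fin 4 → Fin m → ℝ) :
    ymLagrangian c (euclideanMetric 4, firstJet A dA) =
      (1 / 4) * ∑ μ, ∑ ν, fieldStrength c A dA μ ν ⬝ᵥ fieldStrength c A dA μ ν := by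
  simp only [ymLagrangian, firstJet_value]
  change (1 / 4 : ℝ) * ∑ μ, ∑ ν, ∑ ρ, ∑ σ, ∑ a, (if μ = ρ then 1 else 0) * (if ν = σ then 1 else 0) *
    fieldStrength c A dA μ ν a * fieldStrength c A dA ρ σ a = _
  simp [dotProduct]

theorem differentiable_ymLagrangian (g : SymTensor 4) :
    Differentiable ℝ fun j : Jet 4 1 (Fin 4 → Fin m → ℝ) => ymLagrangian c (g, j) := by
  have hF : ∀ μ ν, ContDiffOn ℝ ∞ (fun j : Jet 4 1 (Fin 4 → Fin m → ℝ) =>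
      fieldStrength c j.value j.deriv μ ν) Set.univ :=
    ContDiffOn.fieldStrength (fun μ => (contDiff_pi.1 contDiff_value μ).contDiffOn)
      fun μ ν => (contDiff_pi.1 (contDiff_deriv μ) ν).contDiffOn
  have h : ContDiffOn ℝ ∞ (fun j : Jet 4 1 (Fin 4 → Fin m → ℝ) => ymLagrangian c (g, j))
      Set.univ := by
    simp only [ymLagrangian]
    exact contDiffOn_const.mul (ContDiffOn.sum fun μ _ => ContDiffOn.sum fun ν _ =>
      ContDiffOn.sum fun ρ _ => ContDiffOn.sum fun σ _ => ContDiffOn.sum fun a _ =>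
        (contDiffOn_const.mul (contDiffOn_pi.1 (hF μ ν) a)).mul (contDiffOn_pi.1 (hF ρ σ) a))
  exact (contDiffOn_univ.1 h).differentiable (by simp)

theorem differentiable_ymLagrangian_metric (j : Jet 4 1 (Fin 4 → Fin m → ℝ)) :
    Differentiable ℝ fun g : SymTensor 4 => ymLagrangian c (g, j) := by
  have h : ContDiff ℝ ∞ fun g : SymTensor 4 => ymLagrangian c (g, j) := by
    simp only [ymLagrangian]
    exact contDiff_const.mul (ContDiff.sum fun μ _ => ContDiff.sum fun ν _ =>
      ContDiff.sum fun ρ _ => ContDiff.sum fun σ _ => ContDiff.sum fun a _ =>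
        (((contDiff_component μ ρ).mul (contDiff_component ν σ)).mul contDiff_const).mul
          contDiff_const)
  exact h.differentiable (by simp)

theorem hasDerivAt_ymLagrangian (A δA : Fin 4 → Fin m → ℝ) (dA δdA : Fin 4 → Fin 4 → Fin m → ℝ) :
    HasDerivAt (fun t : ℝ => ymLagrangian c (euclideanMetric 4, firstJet (A + t • δA) (dA + t • δdA)))
      ((1 / 2) * ∑ μ, ∑ ν, fieldStrength c A dA μ ν ⬝ᵥ (δdA μ ν - δdA ν μ +
        (gaugeBracket c (δA μ) (A ν) + gaugeBracket c (A μ) (δA ν)))) 0 := by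
  simp only [ymLagrangian_euclidean]
  have hline : ∀ X Y : Fin m → ℝ, HasDerivAt (fun t : ℝ => X + t • Y) Y 0 := fun X Y => by
    simpa using ((hasDerivAt_id (0 : ℝ)).smul_const Y).const_add X
  have hF : ∀ μ ν, HasDerivAt (fun t : ℝ => fieldStrength c (A + t • δA) (dA + t • δdA) μ ν) _ 0 :=
    HasDerivAt.fieldStrength (fun μ => hline (A μ) (δA μ)) fun μ ν => hline (dA μ ν) (δdA μ ν)
  have h := (HasDerivAt.fun_sum (u := Finset.univ) fun μ _ =>
    HasDerivAt.fun_sum (u := Finset.univ) fun ν _ => HasDerivAt.fun_sum (u := Finset.univ)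
      fun a _ => (hasDerivAt_pi.1 (hF μ ν) a).mul (hasDerivAt_pi.1 (hF μ ν) a)).const_mul
        (1 / 4 : ℝ)
  refine h.congr_deriv ?_
  simp only [zero_smul, add_zero, dotProduct, Finset.mul_sum]
  refine Finset.sum_congr rfl fun μ _ => Finset.sum_congr rfl fun ν _ =>
    Finset.sum_congr rfl fun a _ => ?_
  ring

/-- The self-duality equations make the traceless part of `F_{μρ} F_{νρ}` vanish. -/
theorem selfDual_contraction {s : ℝ} (hs : s = 1 ∨ s = -1) {F : Fin 4 → Fin 4 → ℝ}
    (hF : ∀ μ ν, F μ ν = -F ν μ)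
    (h : F 0 1 = s * F 2 3 ∧ F 0 2 = s * F 3 1 ∧ F 0 3 = s * F 1 2) (μ ν : Fin 4) :
    ∑ ρ, F μ ρ * F ν ρ = (if μ = ν then 1 else 0) * ((1 / 4) * ∑ α, ∑ ρ, F α ρ * F α ρ) := by
  have hd : ∀ μ, F μ μ = 0 := fun μ => by linarith [hF μ μ]
  obtain ⟨h1, h2, h3⟩ := h
  simp only [Fin.sum_univ_four, hd, hF 1 0, hF 2 0, hF 3 0, hF 2 1, hF 1 3, hF 3 2, h1, h2, h3]
  rcases hs with rfl | rfl <;> fin_cases μ <;> fin_cases ν <;>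
    simp [hd, hF 1 0, hF 2 0, hF 3 0, hF 2 1, hF 1 3, hF 3 2, h1, h2, h3] <;> ring

/-- A tensor that is self-dual in its last two indices and satisfies the Bianchi identity is
divergence-free. -/
theorem selfDual_divergence {s : ℝ} (hs : s = 1 ∨ s = -1) {D : Fin 4 → Fin 4 → Fin 4 → ℝ}
    (hD : ∀ κ μ ν, D κ μ ν = -D κ ν μ)
    (h : ∀ κ, D κ 0 1 = s * D κ 2 3 ∧ D κ 0 2 = s * D κ 3 1 ∧ D κ 0 3 = s * D κ 1 2)
    (hB : ∀ κ μ ν, D κ μ ν + D μ ν κ + D ν κ μ = 0) (ν : Fin 4) : ∑ μ, D μ μ ν = 0 := by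
  obtain ⟨a1, a2, a3⟩ := h 0
  obtain ⟨b1, b2, b3⟩ := h 1
  obtain ⟨c1, c2, c3⟩ := h 2
  obtain ⟨d1, d2, d3⟩ := h 3
  have e1 := hB 1 2 3
  have e2 := hB 0 2 3
  have e3 := hB 0 3 1
  have e4 := hB 0 1 2
  simp only [Fin.sum_univ_four]
  rcases hs with rfl | rfl <;> fin_cases ν <;> simp only [Fin.zero_eta, Fin.mk_one, Fin.reduceFinMk]
  -- Each component of the divergence is, up to sign, the Bianchi identity for the three indices
  -- other than ν; the listed antisymmetries bring its terms to the form in the duality relations.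
  all_goals
    linarith [hD 0 0 0, hD 1 1 1, hD 2 2 2, hD 3 3 3, hD 1 1 0, hD 2 2 0, hD 3 3 0, hD 2 2 1,
      hD 2 0 3, hD 3 0 2, hD 1 1 2, hD 1 0 3, hD 3 0 1, hD 3 3 2, hD 1 1 3, hD 2 2 3, hD 1 0 2,
      hD 2 0 1, hD 3 3 1]

/-- The field strength of a gauge potential, as a tensor field. -/
noncomputable def ymField (c : Fin m → Fin m → Fin m → ℝ) (A : (Fin 4 → ℝ) → Fin 4 → Fin m → ℝ)
    (μ ν : Fin 4) (x : Fin 4 → ℝ) : Fin m → ℝ :=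
  fieldStrength c (A x) (fun ρ => fderiv ℝ A x (Pi.single ρ 1)) μ ν

/-- The covariant derivative `D_κ F_{μν}` of the field strength. -/
noncomputable def ymCovariant (c : Fin m → Fin m → Fin m → ℝ)
    (A : (Fin 4 → ℝ) → Fin 4 → Fin m → ℝ) (x : Fin 4 → ℝ) (κ μ ν : Fin 4) : Fin m → ℝ :=
  fderiv ℝ (ymField c A μ ν) x (Pi.single κ 1) + gaugeBracket c (A x κ) (ymField c A μ ν x)

variable {Ω : Set (Fin 4 → ℝ)} {A : (Fin 4 → ℝ) → Fin 4 → Fin m → ℝ} {s : ℝ}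

theorem contDiffOn_ymField (hΩ : IsOpen Ω) (hA : ContDiffOn ℝ ∞ A Ω) (μ ν : Fin 4) :
    ContDiffOn ℝ ∞ (ymField c A μ ν) Ω :=
  ContDiffOn.fieldStrength (contDiffOn_pi.1 hA)
    (fun _ => contDiffOn_pi.1 ((contDiffOn_fderiv_smooth hΩ hA).clm_apply contDiffOn_const)) μ ν

theorem fderiv_ymField (hΩ : IsOpen Ω) (hA : ContDiffOn ℝ ∞ A Ω) {x : Fin 4 → ℝ} (hx : x ∈ Ω)
    (e : Fin 4 → ℝ) (μ ν : Fin 4) :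
    fderiv ℝ (ymField c A μ ν) x e =
      fderiv ℝ (fderiv ℝ A) x e (Pi.single μ 1) ν - fderiv ℝ (fderiv ℝ A) x e (Pi.single ν 1) μ +
        (gaugeBracket c (fderiv ℝ A x e μ) (A x ν) +
          gaugeBracket c (A x μ) (fderiv ℝ A x e ν)) := by
  have h1 : ∀ μ, HasDerivAt (fun t : ℝ => A (x + t • e) μ) (fderiv ℝ A x e μ) 0 :=
    hasDerivAt_pi.1 (hasDerivAt_line e
      ((hA.contDiffAt (hΩ.mem_nhds hx)).differentiableAt (by simp)))
  have h2 : ∀ μ ν, HasDerivAt (fun t : ℝ => fderiv ℝ A (x + t • e) (Pi.single μ 1) ν)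
      (fderiv ℝ (fderiv ℝ A) x e (Pi.single μ 1) ν) 0 := fun μ =>
    hasDerivAt_pi.1 (hasDerivAt_fderiv_line hΩ hA hx e (Pi.single μ 1))
  have h3 := HasDerivAt.fieldStrength (c := c) h1 h2 μ ν
  simp only [zero_smul, add_zero] at h3
  exact fderiv_apply_of_hasDerivAt_line
    (((contDiffOn_ymField hΩ hA μ ν).contDiffAt (hΩ.mem_nhds hx)).differentiableAt (by simp)) h3

theorem IsGaugeAlgebra.ymField_antisymm (hc : IsGaugeAlgebra c) (μ ν : Fin 4) :
    ymField c A μ ν = -ymField c A ν μ :=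
  funext fun _ => hc.fieldStrength_antisymm _ _ μ ν

theorem IsGaugeAlgebra.ymCovariant_antisymm (hc : IsGaugeAlgebra c) (x : Fin 4 → ℝ)
    (κ μ ν : Fin 4) : ymCovariant c A x κ μ ν = -ymCovariant c A x κ ν μ := by
  simp only [ymCovariant, hc.ymField_antisymm μ ν, fderiv_neg, Pi.neg_apply,
    neg_apply, gaugeBracket_neg_right, neg_add]

/-- In the cyclic sum, second derivatives of A cancel by symmetry, terms with one derivative by
antisymmetry of the bracket, and cubic terms by Jacobi. -/
theorem IsGaugeAlgebra.bianchi (hc : IsGaugeAlgebra c) (hΩ : IsOpen Ω) (hA : ContDiffOn ℝ ∞ A Ω)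
    {x : Fin 4 → ℝ} (hx : x ∈ Ω) (κ μ ν : Fin 4) :
    ymCovariant c A x κ μ ν + ymCovariant c A x μ ν κ + ymCovariant c A x ν κ μ = 0 := by
  have hsym := fderiv_fderiv_comm hΩ hA hx
  simp only [ymCovariant, fderiv_ymField hΩ hA hx, ymField, fieldStrength_eq,
    gaugeBracket_add_right, gaugeBracket_sub_right]
  rw [hsym (Pi.single μ 1) (Pi.single κ 1), hsym (Pi.single ν 1) (Pi.single κ 1),
    hsym (Pi.single ν 1) (Pi.single μ 1)]
  have hJ := hc.bracket_jacobi (A x μ) (A x ν) (A x κ)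
  rw [hc.bracket_antisymm (gaugeBracket c (A x μ) (A x ν)),
    hc.bracket_antisymm (gaugeBracket c (A x ν) (A x κ)),
    hc.bracket_antisymm (gaugeBracket c (A x κ) (A x μ))] at hJ
  rw [hc.bracket_antisymm (fderiv ℝ A x (Pi.single κ 1) μ),
    hc.bracket_antisymm (fderiv ℝ A x (Pi.single μ 1) ν),
    hc.bracket_antisymm (fderiv ℝ A x (Pi.single ν 1) κ)]
  rw [← neg_eq_zero, ← hJ]
  abel

theorem IsYMInstanton.field_selfDual (h : IsYMInstanton c s Ω A) (hc : IsGaugeAlgebra c)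
    {x : Fin 4 → ℝ} (hx : x ∈ Ω) :
    ymField c A 0 1 x = s • ymField c A 2 3 x ∧ ymField c A 0 2 x = s • ymField c A 3 1 x ∧
      ymField c A 0 3 x = s • ymField c A 1 2 x := by
  have h1 : ∀ a, _ := fun a => selfDual_components (F := fun μ ν => ymField c A μ ν x a)
    (fun μ ν => congrFun (congrFun (hc.ymField_antisymm μ ν) x) a)
    fun μ ν => h.selfDual x hx μ ν a
  exact ⟨funext fun a => (h1 a).1, funext fun a => (h1 a).2.1, funext fun a => (h1 a).2.2⟩

/-- Duality holds on an open set, so it can be differentiated and passes to DF. -/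
theorem ymCovariant_congr_smul (hΩ : IsOpen Ω) (hA : ContDiffOn ℝ ∞ A Ω) {μ ν ρ σ : Fin 4}
    (h : ∀ x ∈ Ω, ymField c A μ ν x = s • ymField c A ρ σ x) {x : Fin 4 → ℝ} (hx : x ∈ Ω)
    (κ : Fin 4) : ymCovariant c A x κ μ ν = s • ymCovariant c A x κ ρ σ := by
  have he : ymField c A μ ν =ᶠ[𝓝 x] fun y => s • ymField c A ρ σ y :=
    (hΩ.eventually_mem hx).mono h
  have hd : DifferentiableAt ℝ (ymField c A ρ σ) x :=
    ((contDiffOn_ymField hΩ hA ρ σ).contDiffAt (hΩ.mem_nhds hx)).differentiableAt (by simp)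
  have hf : fderiv ℝ (ymField c A μ ν) x = s • fderiv ℝ (ymField c A ρ σ) x :=
    he.fderiv_eq.trans (hd.hasFDerivAt.const_smul s).fderiv
  rw [ymCovariant, ymCovariant, hf, h x hx, gaugeBracket_smul_right, smul_add]
  rfl

/-- The Yang–Mills equations of an (anti-)instanton. -/
theorem IsYMInstanton.divergence (h : IsYMInstanton c s Ω A) (hc : IsGaugeAlgebra c)
    (hs : s = 1 ∨ s = -1) (hΩ : IsOpen Ω) {x : Fin 4 → ℝ} (hx : x ∈ Ω) (ν : Fin 4) :
    ∑ μ, ymCovariant c A x μ μ ν = 0 := by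
  funext a
  rw [Finset.sum_apply]
  refine selfDual_divergence hs (D := fun κ μ ν => ymCovariant c A x κ μ ν a)
    (fun κ μ ν => congrFun (hc.ymCovariant_antisymm x κ μ ν) a) (fun κ => ⟨?_, ?_, ?_⟩)
    (fun κ μ ν => congrFun (hc.bianchi hΩ h.smooth hx κ μ ν) a) ν
  · exact congrFun (ymCovariant_congr_smul hΩ h.smooth
      (fun y hy => (h.field_selfDual hc hy).1) hx κ) a
  · exact congrFun (ymCovariant_congr_smul hΩ h.smooth
      (fun y hy => (h.field_selfDual hc hy).2.1) hx κ) a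
  · exact congrFun (ymCovariant_congr_smul hΩ h.smooth
      (fun y hy => (h.field_selfDual hc hy).2.2) hx κ) a

theorem fderiv_sum_dotProduct (hΩ : IsOpen Ω) {F : Fin 4 → (Fin 4 → ℝ) → Fin m → ℝ}
    (hF : ∀ ν, ContDiffOn ℝ ∞ (F ν) Ω) {x : Fin 4 → ℝ} (hx : x ∈ Ω) (e : Fin 4 → ℝ)
    (v : Fin 4 → Fin m → ℝ) :
    fderiv ℝ (fun y => ∑ ν, F ν y ⬝ᵥ v ν) x e = ∑ ν, fderiv ℝ (F ν) x e ⬝ᵥ v ν := by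
  have h1 : ContDiffOn ℝ ∞ (fun y => ∑ ν, F ν y ⬝ᵥ v ν) Ω :=
    ContDiffOn.sum fun ν _ => ContDiffOn.sum fun a _ =>
      (contDiffOn_pi.1 (hF ν) a).mul contDiffOn_const
  refine fderiv_apply_of_hasDerivAt_line
    ((h1.contDiffAt (hΩ.mem_nhds hx)).differentiableAt (by simp)) ?_
  have hl : ∀ ν, HasDerivAt (fun t : ℝ => F ν (x + t • e)) (fderiv ℝ (F ν) x e) 0 := fun ν =>
    hasDerivAt_line e (((hF ν).contDiffAt (hΩ.mem_nhds hx)).differentiableAt (by simp))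
  exact HasDerivAt.fun_sum fun ν _ => HasDerivAt.fun_sum fun a _ =>
    (hasDerivAt_pi.1 (hl ν) a).mul_const (v ν a)

theorem IsYMInstanton.solvesEOM (h : IsYMInstanton c s Ω A) (hc : IsGaugeAlgebra c)
    (hs : s = 1 ∨ s = -1) (hΩ : IsOpen Ω) :
    SolvesEOM (ymLagrangian c) (euclideanMetric 4) Ω A := by
  refine solvesEOM_of_hasDerivAt hΩ (differentiable_ymLagrangian _)
    (fun x v => -∑ μ, ∑ ν, gaugeBracket c (A x μ) (ymField c A μ ν x) ⬝ᵥ v ν)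
    (fun μ x v => ∑ ν, ymField c A μ ν x ⬝ᵥ v ν) (fun x hx v => ?_) (fun x hx μ v => ?_)
    fun x hx v => ?_
  · have h1 := hasDerivAt_ymLagrangian (c := c) (A x) v
      (fun μ => fderiv ℝ A x (Pi.single μ 1)) 0
    simp only [smul_zero, add_zero] at h1
    refine h1.congr_deriv ?_
    -- Invariance of the inner product moves the bracket onto F. The two bracket terms agree after
    -- exchanging μ and ν, which cancels the factor 1/2.
    have e1 : ∀ μ ν, ymField c A μ ν x ⬝ᵥ gaugeBracket c (v μ) (A x ν) =
        -(gaugeBracket c (A x ν) (ymField c A ν μ x) ⬝ᵥ v μ) := fun μ ν => by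
      rw [hc.bracket_antisymm, dotProduct_neg, hc.dotProduct_bracket, neg_neg,
        hc.ymField_antisymm μ ν, Pi.neg_apply, gaugeBracket_neg_right, neg_dotProduct]
    have e2 : ∀ μ ν, ymField c A μ ν x ⬝ᵥ gaugeBracket c (A x μ) (v ν) =
        -(gaugeBracket c (A x μ) (ymField c A μ ν x) ⬝ᵥ v ν) := fun μ ν =>
      hc.dotProduct_bracket _ _ _
    change (1 / 2 : ℝ) * ∑ μ, ∑ ν, ymField c A μ ν x ⬝ᵥ ((0 : Fin m → ℝ) - 0 +
      (gaugeBracket c (v μ) (A x ν) + gaugeBracket c (A x μ) (v ν))) = _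
    simp only [sub_zero, zero_add, dotProduct_add, e1, e2, Finset.sum_add_distrib,
      Finset.sum_neg_distrib]
    rw [Finset.sum_comm]
    ring
  · have h1 := hasDerivAt_ymLagrangian (c := c) (A x) 0
      (fun μ => fderiv ℝ A x (Pi.single μ 1)) (Pi.single μ v)
    simp only [smul_zero, add_zero] at h1
    refine h1.congr_deriv ?_
    have e0 : ∀ X : Fin m → ℝ, gaugeBracket c 0 X = 0 := fun X => by
      funext a; simp [gaugeBracket]
    have e0' : ∀ X : Fin m → ℝ, gaugeBracket c X 0 = 0 := fun X => by
      funext a; simp [gaugeBracket]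
    change (1 / 2 : ℝ) * ∑ ρ, ∑ σ, ymField c A ρ σ x ⬝ᵥ _ = _
    simp only [Pi.zero_apply, e0, e0', add_zero, dotProduct_sub, Finset.sum_sub_distrib]
    have s1 : ∑ ρ, ∑ σ, ymField c A ρ σ x ⬝ᵥ (Pi.single μ v : Fin 4 → Fin 4 → Fin m → ℝ) ρ σ =
        ∑ σ, ymField c A μ σ x ⬝ᵥ v σ := by
      rw [Finset.sum_eq_single μ (fun ρ _ hρ => by simp [hρ]) (by simp), Pi.single_eq_same]
    have s2 : ∑ ρ, ∑ σ, ymField c A ρ σ x ⬝ᵥ (Pi.single μ v : Fin 4 → Fin 4 → Fin m → ℝ) σ ρ =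
        -∑ σ, ymField c A μ σ x ⬝ᵥ v σ := by
      rw [Finset.sum_comm, Finset.sum_eq_single μ (fun ρ _ hρ => by simp [hρ]) (by simp),
        Pi.single_eq_same, ← Finset.sum_neg_distrib]
      exact Finset.sum_congr rfl fun ν _ => by
        rw [hc.ymField_antisymm ν μ, Pi.neg_apply, neg_dotProduct]
    rw [s1, s2]
    ring
  · simp only [fderiv_sum_dotProduct hΩ (contDiffOn_ymField hΩ h.smooth _) hx]
    have h1 : ∑ ν, (∑ μ, ymCovariant c A x μ μ ν) ⬝ᵥ v ν = 0 :=
      Finset.sum_eq_zero fun ν _ => by rw [h.divergence hc hs hΩ hx, zero_dotProduct]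
    simp only [sum_dotProduct, ymCovariant, add_dotProduct, Finset.sum_add_distrib] at h1
    rw [Finset.sum_comm, Finset.sum_comm (f := fun ν μ => gaugeBracket c _ _ ⬝ᵥ _)] at h1
    linarith

/-- Duality makes ∑ F_{μρ}F_{νρ} equal to δ_{μν} K, where K is the on-shell Lagrangian. Each of the
two metric factors contributes K/4 times the trace of the direction, so -2 ∂L/∂g cancels the trace
term exactly. -/
theorem IsYMInstanton.stressVanishes (h : IsYMInstanton c s Ω A) (hc : IsGaugeAlgebra c)
    (hs : s = 1 ∨ s = -1) : StressVanishes (ymLagrangian c) (euclideanMetric 4) Ω A := by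
  intro x hx
  rw [jet_one_eq]
  set K : ℝ := (1 / 4) * ∑ α, ∑ ρ, ymField c A α ρ x ⬝ᵥ ymField c A α ρ x with hK
  have hG : ∀ μ ν, ∑ ρ, ymField c A μ ρ x ⬝ᵥ ymField c A ν ρ x =
      (if μ = ν then 1 else 0) * K := fun μ ν => by
    have h1 := fun a => selfDual_contraction hs (F := fun μ ν => ymField c A μ ν x a)
      (fun μ ν => congrFun (congrFun (hc.ymField_antisymm μ ν) x) a)
      ⟨congrFun (h.field_selfDual hc hx).1 a, congrFun (h.field_selfDual hc hx).2.1 a,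
        congrFun (h.field_selfDual hc hx).2.2 a⟩ μ ν
    simp only [hK, dotProduct]
    rw [Finset.sum_comm, Finset.sum_congr rfl fun a _ => h1 a, ← Finset.mul_sum, ← Finset.mul_sum,
      Finset.sum_comm]
    congr 2
    exact Finset.sum_congr rfl fun _ _ => Finset.sum_comm
  have hG' : ∀ μ ν, ∑ ρ, ymField c A ρ μ x ⬝ᵥ ymField c A ρ ν x =
      (if μ = ν then 1 else 0) * K := fun μ ν => by
    rw [← hG]
    exact Finset.sum_congr rfl fun ρ _ => by
      rw [hc.ymField_antisymm ρ μ, hc.ymField_antisymm ρ ν, Pi.neg_apply, Pi.neg_apply,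
        neg_dotProduct, dotProduct_neg, neg_neg]
  refine stress_euclidean_eq_zero (differentiable_ymLagrangian_metric _)
    (fun μ ν => (1 / 2) * ((if μ = ν then 1 else 0) * K)) (fun μ ν => ?_) fun μ ν => ?_
  · set M := (metricDirection μ ν).1 with hM
    have hg : ∀ a b, HasDerivAt (fun t : ℝ => (euclideanMetric 4 + t • metricDirection μ ν).1 a b)
        (M a b) 0 := fun a b => by
      simpa using ((hasDerivAt_id (0 : ℝ)).mul_const (M a b)).const_add ((euclideanMetric 4).1 a b)
    have h1 := (HasDerivAt.fun_sum (u := Finset.univ) fun α _ =>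
      HasDerivAt.fun_sum (u := Finset.univ) fun β _ =>
        HasDerivAt.fun_sum (u := Finset.univ) fun ρ _ =>
          HasDerivAt.fun_sum (u := Finset.univ) fun σ _ =>
            HasDerivAt.fun_sum (u := Finset.univ) fun a _ =>
              (((hg α ρ).mul (hg β σ)).mul_const (ymField c A α β x a)).mul_const
                (ymField c A ρ σ x a)).const_mul (1 / 4 : ℝ)
    refine h1.congr_deriv ?_
    have hM1 : ∑ α, M α α = if μ = ν then 1 else 0 := trace_metricDirection μ ν
    have hδ : ∀ α β, (euclideanMetric 4).1 α β = if α = β then 1 else 0 := fun _ _ => rfl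
    have t1 : ∑ α, ∑ β, ∑ ρ, ∑ σ, ∑ a, M α ρ * (if β = σ then 1 else 0) * ymField c A α β x a *
        ymField c A ρ σ x a = (∑ α, M α α) * K := by
      have e : ∀ α, ∑ β, ∑ ρ, ∑ σ, ∑ a, M α ρ * (if β = σ then 1 else 0) * ymField c A α β x a *
          ymField c A ρ σ x a =
          ∑ ρ, M α ρ * ∑ β, ymField c A α β x ⬝ᵥ ymField c A ρ β x := fun α => by
        rw [Finset.sum_comm]
        simp [dotProduct, Finset.mul_sum, mul_assoc]
      simp only [e, hG]
      simp [Finset.sum_mul]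
    have t2 : ∑ α, ∑ β, ∑ ρ, ∑ σ, ∑ a, (if α = ρ then 1 else 0) * M β σ * ymField c A α β x a *
        ymField c A ρ σ x a = (∑ α, M α α) * K := by
      have e : ∀ β, ∑ α, ∑ ρ, ∑ σ, ∑ a, (if α = ρ then 1 else 0) * M β σ * ymField c A α β x a *
          ymField c A ρ σ x a =
          ∑ σ, M β σ * ∑ α, ymField c A α β x ⬝ᵥ ymField c A α σ x := fun β => by
        simp only [dotProduct, Finset.mul_sum]
        rw [Finset.sum_comm (γ := Fin 4) (f := fun σ α => ∑ a, M β σ * _)]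
        refine Finset.sum_congr rfl fun α _ => ?_
        rw [Finset.sum_eq_single α (fun ρ _ hρ => by simp [hρ.symm]) (by simp)]
        simp [mul_assoc]
      rw [Finset.sum_comm]
      simp only [e, hG']
      simp [Finset.sum_mul]
    simp only [zero_smul, add_zero, hδ, add_mul, Finset.sum_add_distrib, t1, t2, hM1]
    ring
  · rw [ymLagrangian_euclidean]
    change -2 * _ + _ * K = 0
    ring

end YangMills

/-! ### The theorem: general statement and both instanton examples -/

theorem mainTheorem1 :
    -- every solution with vanishing stress tensor is undeformed, in any dimension
    (∀ (d r : ℕ) (V : Type*) [NormedAddCommGroup V] [NormedSpace ℝ V]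
      (L₀ : Lagrangian d r V) (g₀ : SymTensor d) (Ω : Set (Fin d → ℝ)) (φ : (Fin d → ℝ) → V),
      IsOpen Ω → ContDiffOn ℝ ((2 * r : ℕ) : ℕ∞) φ Ω →
      SolvesEOM L₀ g₀ Ω φ → StressVanishes L₀ g₀ Ω φ →
      UndeformedByStressFlows L₀ g₀ Ω φ) ∧
    -- two-dimensional instantons of the projective sigma model
    (∀ (N : ℕ) (s : ℝ) (Ω : Set (Fin 2 → ℝ)) (φ : (Fin 2 → ℝ) → Fin N → ℂ),
      (s = 1 ∨ s = -1) → IsOpen Ω → IsCPInstanton s Ω φ →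
      ∃ lam : (Fin 2 → ℝ) → ℝ, ContDiffOn ℝ ∞ lam Ω ∧
        SolvesEOM (cpLagrangian N) (euclideanMetric 2) Ω (fun x => (φ x, lam x)) ∧
        StressVanishes (cpLagrangian N) (euclideanMetric 2) Ω (fun x => (φ x, lam x)) ∧
        UndeformedByStressFlows (cpLagrangian N) (euclideanMetric 2) Ω
          (fun x => (φ x, lam x))) ∧
    -- four-dimensional Yang-Mills instantons
    (∀ (m : ℕ) (c : Fin m → Fin m → Fin m → ℝ) (s : ℝ) (Ω : Set (Fin 4 → ℝ))
      (A : (Fin 4 → ℝ) → Fin 4 → Fin m → ℝ),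
      IsGaugeAlgebra c → (s = 1 ∨ s = -1) → IsOpen Ω → IsYMInstanton c s Ω A →
      SolvesEOM (ymLagrangian c) (euclideanMetric 4) Ω A ∧
        StressVanishes (ymLagrangian c) (euclideanMetric 4) Ω A ∧
        UndeformedByStressFlows (ymLagrangian c) (euclideanMetric 4) Ω A) := by

  refine ⟨fun d r V _ _ L₀ g₀ Ω φ hΩ _ heom hT => undeformedByStressFlows hΩ heom hT,
    fun N s Ω φ hs hΩ h => ?_, fun m c s Ω A hc hs hΩ h => ?_⟩
  · have heom := h.solvesEOM hΩ
    have hT := h.stressVanishes hs hΩ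
    exact ⟨cpMultiplier s φ, h.contDiffOn_multiplier hΩ, heom, hT,
      undeformedByStressFlows hΩ heom hT⟩
  · have heom := h.solvesEOM hc hs hΩ
    have hT := h.stressVanishes hc hs
    exact ⟨heom, hT, undeformedByStressFlows hΩ heom hT⟩
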